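/- Let $d\ge 1$. For a path $X:[0,1]\to\mathbb R^d$ of bounded variation and a word $w=(i_1,\dots,i_k)\in\{1,\dots,d\}^k$ let $$S^w(X)=\int\cdots\int_{0\le u_1<\cdots<u_k\le 1}dX^{i_1}_{u_1}\cdots dX^{i_k}_{u_k}$$ (Lebesgue–Stieltjes integrals, with value $1$ for the empty word), and let $S^m(X)=(S^w(X))_{|w|\le m}\in\mathbb R^{s_d(m)}$, $s_d(m)=\sum_{k=0}^m d^k$, be the signature truncated at order $m$. Norms and scalar products are Euclidean. Let $(X,Y)$ be a random pair, where $X$ is a random path of bounded variation in $\mathbb R^d$ and $Y$ is a real random variable. Assume that there are $m\in\mathbb N$ and $\beta\in\mathbb R^{s_d(m)}$ with $\mathbb E[Y\mid X]=\langle\beta,S^m(X)\rangle$ almost surely, let $m^\ast$ be the smallest such $m$, and let $\beta^\ast_{m^\ast}\in\mathbb R^{s_d(m^\ast)}$ satisfy $\mathbb E[Y\mid X]=\langle\beta^\ast_{m^\ast},S^{m^\ast}(X)\rangle$ almost surely. Fix $\alpha>0$ and assume: - $(H_\alpha)$ $\|\beta^\ast_{m^\ast}\|\le\alpha$; - $(H_K)$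 there are $K_Y,K_X>0$ such that almost surely $|Y|\le K_Y$ and the total variation of $X$ satisfies $\|X\|_{TV}\le K_X$. Let $(X_1,Y_1),(X_2,Y_2),\dots$ be i.i.d. copies of $(X,Y)$, jointly independent of $(X,Y)$. For $n\ge1$ and $m\in\mathbb N$ let $$\widehat{\mathcal R}_{m,n}(\beta)=\frac1n\sum_{i=1}^n\big(Y_i-\langle\beta,S^m(X_i)\rangle\big)^2,\qquad \widehat L_n(m)=\min_{\|\beta\|\le\alpha}\widehat{\mathcal R}_{m,n}(\beta),$$ the minimum being over $\beta\in\mathbb R^{s_d(m)}$, and let $\widehat\beta_m$ be any measurable function of the sample $(X_1,Y_1),\dots,(X_n,Y_n)$ with $\|\widehat\beta_m\|\le\alpha$ at which this minimum is attained. Let $K_{\rm pen}>0$, $0<\rho<\frac12$, $\mathrm{pen}_n(m)=K_{\rm pen}\,n^{-\rho}\sqrt{s_d(m)}$, and let $\widehat m$ be the smallest minimizer over $m\in\mathbb N$ of $\widehat L_n(m)+\mathrm{pen}_n(m)$. Then, as $n\to\infty$, $$\mathbb E\Big[\big(\langle\widehat\beta_{\widehat m},S^{\widehat m}(X)\rangle-\langle\beta^\ast_{m^\ast},S^{m^\ast}(X)\rangle\big)^2\Big]=\mathcal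 O\big(n^{-1/2}\big)$$ (the expectation, over the sample and $(X,Y)$, being that of an integrable random variable). -/

import Mathlib

open MeasureTheory ProbabilityTheory Filter
open scoped Asymptotics unitInterval

noncomputable section

namespace SigReg

/-- Paths `[0,1] → ℝ^d` of bounded variation (for the Euclidean norm on `ℝ^d`). -/
def BVPath (d : ℕ) : Type :=
  {X : I → EuclideanSpace ℝ (Fin d) // BoundedVariationOn X Set.univ}

namespace BVPath

variable {d : ℕ}

/-- The path space carries the σ-algebra generated by the evaluations `X ↦ X_t`, so that a
measurable map into it is a stochastic process on `[0,1]` with paths of bounded variation. -/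
instance : MeasurableSpace (BVPath d) := Subtype.instMeasurableSpace

/-- Total variation `‖X‖_TV`. -/
def tv (X : BVPath d) : ENNReal := eVariationOn X.1 Set.univ

/-- The `i`-th coordinate of a path. -/
def coord (X : BVPath d) (i : Fin d) : I → ℝ := fun t => X.1 t i

theorem coord_boundedVariationOn (X : BVPath d) (i : Fin d) :
    BoundedVariationOn (X.coord i) Set.univ := by
  have h : LipschitzWith 1 (fun v : EuclideanSpace ℝ (Fin d) => v i) :=
    LipschitzWith.of_dist_le_mul fun v w => by
      simpa [dist_eq_norm] using PiLp.norm_apply_le (v - w) i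
  exact h.comp_boundedVariationOn X.2

/-- The Lebesgue–Stieltjes (signed) measure `dX^i` on `[0,1]`. Its mass on `[a,b]` is
`X^i_{b+} - X^i_{a-}`, with the conventions `X_{0-} = X_0` and `X_{1+} = X_1`. -/
def stieltjes (X : BVPath d) (i : Fin d) : VectorMeasure I ℝ :=
  (X.coord_boundedVariationOn i).vectorMeasure

/-- The iterated integral `∫ ⋯ ∫ dX^{i_1}_{u_1} ⋯ dX^{i_k}_{u_k}` over `u_1 < ⋯ < u_k`, `u_k ∈ s`,
for a word `w = (i_1, …, i_k)`; the empty word gives `1`. -/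
def iterInt (X : BVPath d) : (k : ℕ) → (Fin k → Fin d) → Set I → ℝ
  | 0, _, _ => 1
  | k + 1, w, s =>
      ∫ᵛ u in s, iterInt X k (Fin.init w) (Set.Iio u) ∂•(X.stieltjes (w (Fin.last k)))

/-- The signature coefficient of `X` along the word `w`: the iterated integral over
`0 ≤ u_1 < ⋯ < u_k ≤ 1`. -/
def sigCoeff (X : BVPath d) {k : ℕ} (w : Fin k → Fin d) : ℝ :=
  X.iterInt k w Set.univ

end BVPath

/-- Words of length at most `m` in the letters `1, …, d`: the indices of the coefficients of the
signature truncated at order `m`. -/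
abbrev Word (d m : ℕ) : Type := (k : Fin (m + 1)) × (Fin k → Fin d)

/-- `s_d(m) = 1 + d + ⋯ + d^m`. -/
def sigDim (d m : ℕ) : ℕ := ∑ k ∈ Finset.range (m + 1), d ^ k

/-- The Euclidean space `ℝ^{s_d(m)}`, with coordinates indexed by the words of length at
most `m`. -/
abbrev Coeff (d m : ℕ) : Type := EuclideanSpace ℝ (Word d m)

variable {d : ℕ}

/-- The signature truncated at order `m`. -/
def truncSig (m : ℕ) (X : BVPath d) : Coeff d m :=
  WithLp.toLp 2 fun w => X.sigCoeff w.2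

/-- A sample of `n` observations (path, response). -/
abbrev Sample (d n : ℕ) : Type := Fin n → BVPath d × ℝ

/-- The empirical risk `(1/n) ∑_i (Y_i - ⟨β, S^m(X_i)⟩)²`. -/
def empRisk {n : ℕ} (D : Sample d n) (m : ℕ) (β : Coeff d m) : ℝ :=
  (1 / (n : ℝ)) * ∑ i, ((D i).2 - inner ℝ β (truncSig m (D i).1)) ^ 2

/-- The minimal empirical risk at order `m` over the ball of radius `α`. -/
def minEmpRisk (α : ℝ) {n : ℕ} (D : Sample d n) (m : ℕ) : ℝ :=
  ⨅ β : Metric.closedBall (0 : Coeff d m) α, empRisk D m β.1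

/-- The penalty `K_pen n^{-ρ} √(s_d(m))`. -/
def pen (d : ℕ) (Kpen ρ : ℝ) (n m : ℕ) : ℝ :=
  Kpen * (n : ℝ) ^ (-ρ) * √(sigDim d m : ℝ)

/-- The estimator of the truncation order: the smallest minimizer over `m ∈ ℕ` of the penalized
minimal empirical risk. -/
def mHat (α Kpen ρ : ℝ) {n : ℕ} (D : Sample d n) : ℕ :=
  sInf {m | ∀ m' : ℕ,
    minEmpRisk α D m + pen d Kpen ρ n m ≤ minEmpRisk α D m' + pen d Kpen ρ n m'}

/-- `b` is a (measurable) choice of the empirical risk minimizer at order `m`, for samples of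
size `n`, over the ball of radius `α`. -/
structure IsERM (α : ℝ) {n m : ℕ} (b : Sample d n → Coeff d m) : Prop where
  measurable : Measurable b
  norm_le : ∀ D, ‖b D‖ ≤ α
  isMin : ∀ D, ∀ β : Coeff d m, ‖β‖ ≤ α → empRisk D m (b D) ≤ empRisk D m β

/-- The regression function of `Y` on `X` is the linear form `β` on the signature of `X`
truncated at order `m`: `E[Y | X] = ⟨β, S^m(X)⟩` almost surely. -/
def IsRegression {Ω : Type*} [MeasurableSpace Ω] (P : Measure Ω) (X : Ω → BVPath d) (Y : Ω → ℝ)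
    (m : ℕ) (β : Coeff d m) : Prop :=
  P[Y | MeasurableSpace.comap X inferInstance] =ᵐ[P] fun ω => inner ℝ β (truncSig m (X ω))

end SigReg

end

/-! ### Total variation of the signed measure of a function of bounded variation. -/

section StieltjesVariation

open Set Topology

/-! Factorial decay of iterated integrals bounds `‖S^m(X)‖` by a constant `B` independent of `m`
(`exists_norm_truncSig_sq_le`), so every estimate can be made uniform in the truncation order.

Embed coefficient vectors in a common order `M` by zero padding, and let `γ` be the difference of
the estimated and the true coefficients. The excess risk is the quadratic form of the population
Gram matrix of `S^M(X)` at `γ`. The difference of empirical risks is the same form for the empirical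
Gram matrix, minus twice the pairing of `γ` with the empirical correlations of residuals and
signature, which have mean zero. By Cauchy–Schwarz, and since `‖γ‖ ≤ 2α`, the error is at most a
multiple of the Euclidean norms of these two deviations. Their means are at most `C n^{-1/2}`,
because variances add and the second moment of the whole vector, not its dimension, is what counts
(`integral_fluctuation_le`).

The penalty costs nothing in the rate (`quadForm_mHat_le`). If the selected order is at least the
true one, the penalty difference has the favourable sign. If it is smaller, the excess risk is at
least some `δ > 0` by compactness (`exists_pos_le_excess_risk`); the penalty of the true order tends
to zero, so it is eventually at most half the excess risk and is absorbed.

Finally, independence of the fresh path turns the prediction error into the mean of the quadratic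
form at the random `γ`. The selected order is unbounded, so this is done on `{mhat ≤ M}` before
letting `M → ∞`. -/

theorem BoundedVariationOn.exists_vectorMeasure_le_stieltjesFunctionRightLim {f : I → ℝ}
    (hf : BoundedVariationOn f univ) :
    ∃ m : VectorMeasure I ℝ, (∀ u v, u ≤ v → m (Ioc u v) = f.rightLim v - f.rightLim u) ∧
      ∀ s, ‖m s‖ₑ ≤ (hf.stieltjesFunctionRightLim 0).measure s := by
  have : IsFiniteMeasure (hf.stieltjesFunctionRightLim 0).measure :=
    StieltjesFunction.isFiniteMeasure_of_forall_abs_le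
      (C := (eVariationOn f.rightLim univ).toReal) _
      fun x => variationOnFromTo.abs_le_eVariationOn hf.rightLim
  -- Domination on half-open intervals by a finite measure is what allows the extension of their
  -- increments to a vector measure, with the same domination.
  have A : ∀ s ∈ {s | ∃ u v, u ≤ v ∧ s = Ioc u v},
      ‖AddContent.onIoc f.rightLim s‖ₑ ≤ (hf.stieltjesFunctionRightLim 0).measure s := by
    rintro s ⟨u, v, huv, rfl⟩
    rw [AddContent.onIoc_apply huv]
    simp only [StieltjesFunction.measure_Ioc, BoundedVariationOn.stieltjesFunctionRightLim_apply]
    rw [← variationOnFromTo.add hf.rightLim.locallyBoundedVariationOn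
      (mem_univ 0) (mem_univ u) (mem_univ v)]
    simp only [add_sub_cancel_left, variationOnFromTo, huv, ↓reduceIte, univ_inter]
    rw [ENNReal.ofReal_toReal]; swap
    · exact ((eVariationOn.mono _ (subset_univ _)).trans_lt hf.rightLim.lt_top).ne
    rw [← edist_eq_enorm_sub]
    exact eVariationOn.edist_le _ (by grind) (by grind)
  have B : (inferInstance : MeasurableSpace I) =
      MeasurableSpace.generateFrom {s | ∃ u v, u ≤ v ∧ s = Ioc u v} := by
    rw [BorelSpace.measurable_eq (α := I)]
    convert! borel_eq_generateFrom_Ioc_le I using 2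
    grind only
  obtain ⟨m, hm, hm'⟩ :=
    VectorMeasure.exists_extension_of_isSetSemiring_of_le_measure_of_generateFrom
      IsSetSemiring.Ioc A B
  refine ⟨m, fun u v huv => ?_, hm'⟩
  rw [hm _ ⟨u, v, huv, rfl⟩, AddContent.onIoc_apply huv]

theorem BoundedVariationOn.stieltjesFunctionRightLim_measure_univ_le {f : I → ℝ}
    (hf : BoundedVariationOn f univ) :
    (hf.stieltjesFunctionRightLim 0).measure univ ≤ eVariationOn f univ := by
  have h0 : IsBot (0 : I) := fun x => x.2.1
  have hu : (univ : Set I) = Icc 0 1 := (eq_univ_of_forall (s := Icc (0 : I) 1) fun x => ⟨x.2.1, x.2.2⟩).symm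
  calc (hf.stieltjesFunctionRightLim 0).measure univ
      = (hf.stieltjesFunctionRightLim 0).measure (Icc 0 1) := by rw [← hu]
    _ = ENNReal.ofReal (variationOnFromTo f.rightLim univ 0 1) := by
        rw [StieltjesFunction.measure_Icc, leftLim_eq_of_isBot h0]
        simp [variationOnFromTo.self]
    _ ≤ eVariationOn f.rightLim univ := by
        rw [variationOnFromTo.eq_of_le _ _ (h0 1)]
        exact ENNReal.ofReal_toReal_le.trans (eVariationOn.mono _ (subset_univ _))
    _ ≤ eVariationOn f univ := eVariationOn.eVariationOn_rightLim_le isOpen_univ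

/-- The measure splits into the one generated by the right limits on half-open intervals and an atom
at `0`. Each has variation at most that of `f`; bounding them separately costs the harmless factor
2. -/
theorem BoundedVariationOn.vectorMeasure_variation_univ_le {f : I → ℝ}
    (hf : BoundedVariationOn f univ) :
    hf.vectorMeasure.variation univ ≤ 2 * eVariationOn f univ := by
  obtain ⟨m, hm, hmle⟩ := hf.exists_vectorMeasure_le_stieltjesFunctionRightLim
  have h0 : IsBot (0 : I) := fun x => x.2.1
  have hu : (univ : Set I) = {0} ∪ Ioc 0 1 := by
    ext x
    have := x.2.1
    have := x.2.2
    simp only [mem_univ, mem_union, mem_singleton_iff, mem_Ioc, true_iff]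
    rcases (h0 x).eq_or_lt with h | h
    · exact Or.inl h.symm
    · exact Or.inr ⟨h, x.2.2⟩
  have hd : Disjoint ({0} : Set I) (Ioc 0 1) := by simp
  have hm0 : m {0} = 0 := by
    apply enorm_eq_zero.1
    apply le_bot_iff.1
    refine (hmle _).trans ?_
    rw [← botSet_eq_singleton_of_isBot h0, StieltjesFunction.measure_botSet]
    rfl
  set c := f.rightLim 0 - f 0 with hc
  have key : hf.vectorMeasure = m + VectorMeasure.dirac 0 c := by
    refine VectorMeasure.ext_of_generateFrom {s | ∃ u v, u ≤ v ∧ s = Ioc u v} ?_ ?_ ?_ ?_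
    · rintro s ⟨u, v, huv, rfl⟩
      rw [hf.vectorMeasure_Ioc huv, _root_.add_apply, hm u v huv,
        VectorMeasure.dirac_apply_of_notMem, add_zero]
      exact fun h => absurd h.1 (not_lt.2 (h0 u))
    · rw [BorelSpace.measurable_eq (α := I)]
      convert! borel_eq_generateFrom_Ioc_le I using 2
      grind only
    · rintro _ ⟨u, v, huv, rfl⟩ _ ⟨u', v', huv', rfl⟩ ⟨x, hx⟩
      rw [Ioc_inter_Ioc] at hx ⊢
      exact ⟨_, _, (hx.1.trans_le hx.2).le, rfl⟩
    · rw [hu, VectorMeasure.of_union hd (measurableSet_singleton _) measurableSet_Ioc,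
        VectorMeasure.of_union hd (measurableSet_singleton _) measurableSet_Ioc,
        hf.vectorMeasure_singleton, hf.vectorMeasure_Ioc (h0 1), _root_.add_apply,
        _root_.add_apply, hm0, hm _ _ (h0 1),
        VectorMeasure.dirac_apply_of_mem (measurableSet_singleton _) (mem_singleton _),
        VectorMeasure.dirac_apply_of_notMem (by simp), leftLim_eq_of_isBot h0]
      simp [hc]
  have hvm : m.variation univ ≤ eVariationOn f univ :=
    (VectorMeasure.variation_le_of_forall_enorm_le (fun E _ => hmle E) univ).trans
      hf.stieltjesFunctionRightLim_measure_univ_le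
  have hvd : (VectorMeasure.dirac (0 : I) c).variation univ ≤ eVariationOn f univ := by
    rw [VectorMeasure.variation_dirac]
    simp only [Measure.smul_apply, measure_univ, smul_eq_mul, mul_one]
    have : (𝓝[>] (0 : I)).NeBot := nhdsGT_neBot_of_exists_gt ⟨1, by simp⟩
    -- The jump at `0` is a limit of increments of `f`, each at most its variation.
    have hlim : Tendsto (fun x => ‖f x - f 0‖ₑ) (𝓝[>] (0 : I)) (𝓝 ‖c‖ₑ) :=
      ((hf.tendsto_rightLim 0).sub_const _).enorm
    refine le_of_tendsto hlim (Eventually.of_forall fun x => ?_)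
    rw [← edist_eq_enorm_sub]
    exact eVariationOn.edist_le _ (mem_univ _) (mem_univ _)
  rw [key, two_mul]
  exact ((VectorMeasure.variation_add_le) univ).trans (add_le_add hvm hvd)

end StieltjesVariation

/-! ### Factorial decay of simplex masses. -/

section IteratedLIntegral

open Set

/-- The mass `μ^k {u_1 < ⋯ < u_k < t}` of the open simplex under a product measure. -/
noncomputable def simplexMass (μ : Measure I) : ℕ → I → ENNReal
  | 0, _ => 1
  | k + 1, t => ∫⁻ u in Iio t, simplexMass μ k u ∂μ

theorem monotone_simplexMass (μ : Measure I) (k : ℕ) : Monotone (simplexMass μ k) := by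
  cases k with
  | zero => exact fun _ _ _ => le_rfl
  | succ k => exact fun s t h => lintegral_mono_set (Iio_subset_Iio h)

/-- Add a free point `u` to a chain with largest point `v`. The region `u > v` gives one longer
simplex by Fubini; the region `u < v` gives `k + 1` more by induction. The diagonal `u = v` is
discarded, so atoms of `μ` only cause an inequality. -/
theorem succ_mul_simplexMass_succ_le (μ : Measure I) [IsFiniteMeasure μ] (k : ℕ) (t : I) :
    (k + 1 : ENNReal) * simplexMass μ (k + 1) t ≤ simplexMass μ 1 t * simplexMass μ k t := by
  induction k generalizing t with
  | zero => simp [simplexMass]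
  | succ k ih =>
    have hA := (monotone_simplexMass μ k).measurable
    have hA1 := (monotone_simplexMass μ (k + 1)).measurable
    have h1 : simplexMass μ 1 t * simplexMass μ (k + 1) t
        = ∫⁻ v in Iio t, (∫⁻ _ in Iio t, simplexMass μ k v ∂μ) ∂μ := by
      simp only [simplexMass, lintegral_const, one_mul]
      rw [lintegral_mul_const _ hA, mul_comm]
    have hmeas : Measurable (Function.uncurry fun v u : I =>
        (Iio v).indicator (fun _ => simplexMass μ k v) u) := by
      have : (Function.uncurry fun v u : I =>
          (Iio v).indicator (fun _ => simplexMass μ k v) u)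
          = {p : I × I | p.2 < p.1}.indicator fun p => simplexMass μ k p.1 := by
        ext ⟨v, u⟩
        simp [indicator]
      rw [this]
      exact (hA.comp measurable_fst).indicator (measurableSet_lt measurable_snd measurable_fst)
    have hmeas' : Measurable (Function.uncurry fun v u : I =>
        (Ioi v).indicator (fun _ => simplexMass μ k v) u) := by
      have : (Function.uncurry fun v u : I =>
          (Ioi v).indicator (fun _ => simplexMass μ k v) u)
          = {p : I × I | p.1 < p.2}.indicator fun p => simplexMass μ k p.1 := by
        ext ⟨v, u⟩
        simp [indicator]
      rw [this]
      exact (hA.comp measurable_fst).indicator (measurableSet_lt measurable_fst measurable_snd)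
    have h2 : (∫⁻ v in Iio t, (∫⁻ u in Iio t,
          (Iio v).indicator (fun _ => simplexMass μ k v) u ∂μ) ∂μ)
        + ∫⁻ v in Iio t, (∫⁻ u in Iio t,
          (Ioi v).indicator (fun _ => simplexMass μ k v) u ∂μ) ∂μ
        ≤ simplexMass μ 1 t * simplexMass μ (k + 1) t := by
      rw [h1, ← lintegral_add_left hmeas.lintegral_prod_right]
      refine lintegral_mono fun v => ?_
      rw [← lintegral_add_left (measurable_const.indicator measurableSet_Iio)]
      refine lintegral_mono fun u => ?_
      rcases lt_trichotomy u v with h | h | h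
      · simp [indicator, h, h.not_gt]
      · simp [indicator, h]
      · simp [indicator, h, h.not_gt]
    have h3 : (k + 1 : ENNReal) * simplexMass μ (k + 2) t
        ≤ ∫⁻ v in Iio t, (∫⁻ u in Iio t,
          (Iio v).indicator (fun _ => simplexMass μ k v) u ∂μ) ∂μ := by
      change (k + 1 : ENNReal) * ∫⁻ v in Iio t, simplexMass μ (k + 1) v ∂μ ≤ _
      rw [← lintegral_const_mul _ hA1]
      refine setLIntegral_mono' measurableSet_Iio fun v hv => (ih v).trans ?_
      rw [lintegral_indicator measurableSet_Iio, lintegral_const,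
        Measure.restrict_restrict measurableSet_Iio,
        inter_eq_left.2 (Iio_subset_Iio (le_of_lt hv)), mul_comm]
      simp [simplexMass]
    have h4 : simplexMass μ (k + 2) t = ∫⁻ v in Iio t, (∫⁻ u in Iio t,
          (Ioi v).indicator (fun _ => simplexMass μ k v) u ∂μ) ∂μ := by
      rw [lintegral_lintegral_swap hmeas'.aemeasurable]
      change ∫⁻ u in Iio t, simplexMass μ (k + 1) u ∂μ = _
      refine setLIntegral_congr_fun measurableSet_Iio fun u hu => ?_
      change ∫⁻ v in Iio u, simplexMass μ k v ∂μ = _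
      have : (fun v => (Ioi v).indicator (fun _ => simplexMass μ k v) u)
          = (Iio u).indicator fun v => simplexMass μ k v := by
        ext v
        simp [indicator]
      simp only [this]
      rw [lintegral_indicator measurableSet_Iio, Measure.restrict_restrict measurableSet_Iio,
        inter_eq_left.2 (Iio_subset_Iio (le_of_lt hu))]
    calc ((k + 1 : ℕ) + 1 : ENNReal) * simplexMass μ (k + 2) t
        = (k + 1 : ENNReal) * simplexMass μ (k + 2) t + simplexMass μ (k + 2) t := by
          push_cast; ring
      _ ≤ _ := add_le_add h3 h4.le
      _ ≤ _ := h2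

theorem factorial_mul_simplexMass_le (μ : Measure I) [IsFiniteMeasure μ] (k : ℕ) (t : I) :
    (k.factorial : ENNReal) * simplexMass μ k t ≤ μ univ ^ k := by
  induction k with
  | zero => simp [simplexMass]
  | succ k ih =>
    calc ((k + 1).factorial : ENNReal) * simplexMass μ (k + 1) t
        = k.factorial * ((k + 1 : ENNReal) * simplexMass μ (k + 1) t) := by
          rw [Nat.factorial_succ]; push_cast; ring
      _ ≤ k.factorial * (simplexMass μ 1 t * simplexMass μ k t) := by
          exact mul_le_mul_right (succ_mul_simplexMass_succ_le μ k t) _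
      _ = simplexMass μ 1 t * (k.factorial * simplexMass μ k t) := by ring
      _ ≤ μ univ * μ univ ^ k := by
          gcongr
          simp only [simplexMass, lintegral_const, one_mul, Measure.restrict_apply_univ]
          exact measure_mono (subset_univ _)
      _ = μ univ ^ (k + 1) := by ring

end IteratedLIntegral

/-! ### Step-function approximation of left-continuous functions. -/

section LeftContinuous

open Set Topology

/-- The point `j / (n + 1)` of `[0,1]` (capped at `1`). -/
noncomputable def gridPoint (n j : ℕ) : I :=
  projIcc 0 1 zero_le_one ((j : ℝ) / (n + 1))

/-- The index of the last grid point of mesh `1 / (n + 1)` that is at most `u`. -/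
noncomputable def gridIndex (n : ℕ) (u : I) : ℕ := ⌊((n : ℝ) + 1) * u⌋₊

theorem measurable_gridIndex (n : ℕ) : Measurable (gridIndex n) :=
  Nat.measurable_floor.comp (measurable_subtype_coe.const_mul _)

theorem gridIndex_lt (n : ℕ) (u : I) : gridIndex n u < n + 2 := by
  rw [gridIndex, Nat.floor_lt (mul_nonneg (by positivity) u.2.1)]
  push_cast
  -- The index `n + 1` does occur, at `u = 1`; hence the bound `n + 2`.
  nlinarith [u.2.2, u.2.1, (Nat.cast_nonneg n : (0 : ℝ) ≤ n)]

theorem coe_gridPoint_gridIndex (n : ℕ) (u : I) :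
    (gridPoint n (gridIndex n u) : ℝ) = (gridIndex n u : ℝ) / (n + 1) := by
  have hn : (0 : ℝ) < n + 1 := by positivity
  have h := Nat.floor_le (mul_nonneg hn.le u.2.1)
  have h1 : ((gridIndex n u : ℕ) : ℝ) / (n + 1) ≤ u := by
    rw [div_le_iff₀ hn]; unfold gridIndex; linarith
  rw [gridPoint, projIcc_of_mem _ (⟨by positivity, h1.trans u.2.2⟩ : _ ∈ Icc (0 : ℝ) 1)]

theorem gridPoint_gridIndex_le (n : ℕ) (u : I) : gridPoint n (gridIndex n u) ≤ u := by
  have hn : (0 : ℝ) < n + 1 := by positivity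
  have h := Nat.floor_le (mul_nonneg hn.le u.2.1)
  rw [← Subtype.coe_le_coe, coe_gridPoint_gridIndex, div_le_iff₀ hn]
  unfold gridIndex
  linarith

theorem tendsto_gridPoint_gridIndex (u : I) :
    Tendsto (fun n => gridPoint n (gridIndex n u)) atTop (𝓝[≤] u) := by
  refine tendsto_nhdsWithin_of_tendsto_nhds_of_eventually_within _ ?_
    (Eventually.of_forall fun n => gridPoint_gridIndex_le n u)
  rw [tendsto_subtype_rng]
  have h1 : Tendsto (fun n : ℕ => (u : ℝ) - 1 / ((n : ℝ) + 1)) atTop (𝓝 (u : ℝ)) := by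
    simpa using tendsto_const_nhds.sub (tendsto_one_div_add_atTop_nhds_zero_nat (𝕜 := ℝ))
  refine tendsto_of_tendsto_of_tendsto_of_le_of_le h1 tendsto_const_nhds (fun n => ?_)
    fun n => gridPoint_gridIndex_le n u
  have hn : (0 : ℝ) < n + 1 := by positivity
  have h := Nat.lt_floor_add_one (((n : ℝ) + 1) * u)
  change (u : ℝ) - 1 / ((n : ℝ) + 1) ≤ gridPoint n (gridIndex n u)
  rw [coe_gridPoint_gridIndex, sub_le_iff_le_add, ← add_div, le_div_iff₀ hn]
  unfold gridIndex
  linarith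

theorem measurable_comp_grid (f : I → ℝ) (n : ℕ) :
    Measurable fun u => f (gridPoint n (gridIndex n u)) :=
  (measurable_from_nat (f := fun j => f (gridPoint n j))).comp (measurable_gridIndex n)

theorem tendsto_comp_grid {f : I → ℝ} {u : I} (hf : ContinuousWithinAt f (Iic u) u) :
    Tendsto (fun n => f (gridPoint n (gridIndex n u))) atTop (𝓝 (f u)) :=
  hf.tendsto.comp (tendsto_gridPoint_gridIndex u)

theorem measurable_of_forall_continuousWithinAt_Iic {f : I → ℝ}
    (hf : ∀ u, ContinuousWithinAt f (Iic u) u) : Measurable f :=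
  measurable_of_tendsto_metrizable (measurable_comp_grid f)
    (tendsto_pi_nhds.2 fun u => tendsto_comp_grid (hf u))

theorem comp_grid_eq_sum_indicator (f : I → ℝ) (n : ℕ) :
    (fun u => f (gridPoint n (gridIndex n u))) = fun u => ∑ j ∈ Finset.range (n + 2),
      (gridIndex n ⁻¹' {j}).indicator (fun _ => f (gridPoint n j)) u := by
  ext u
  rw [Finset.sum_eq_single (gridIndex n u)]
  · simp
  · intro j _ hj
    simp [hj.symm]
  · intro h
    exact absurd (Finset.mem_range.2 (gridIndex_lt n u)) h

end LeftContinuous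

/-! ### Bounds and measurability of iterated integrals. -/

namespace SigReg.BVPath

open Set Topology

variable {d : ℕ}

instance (X : BVPath d) (i : Fin d) : IsFiniteMeasure (X.stieltjes i).variation := by
  rw [← SignedMeasure.totalVariation_eq_variation]
  infer_instance

theorem coord_eVariationOn_le (X : BVPath d) (i : Fin d) :
    eVariationOn (X.coord i) univ ≤ X.tv := by
  have h : LipschitzWith 1 (fun v : EuclideanSpace ℝ (Fin d) => v i) :=
    LipschitzWith.of_dist_le_mul fun v w => by
      simpa [dist_eq_norm] using PiLp.norm_apply_le (v - w) i
  have := (h.lipschitzOnWith (s := univ)).comp_eVariationOn_le (g := X.1)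
    (mapsTo_univ _ univ)
  rw [ENNReal.coe_one, one_mul] at this
  exact this

/-- A measure dominating the total variations of all the coordinates. -/
noncomputable def domMeasure (X : BVPath d) : Measure I := ∑ i, (X.stieltjes i).variation

instance (X : BVPath d) : IsFiniteMeasure X.domMeasure := by
  unfold domMeasure; infer_instance

theorem variation_le_domMeasure (X : BVPath d) (i : Fin d) :
    (X.stieltjes i).variation ≤ X.domMeasure := by
  refine Measure.le_iff.2 fun s _ => ?_
  rw [domMeasure, Measure.finsetSum_apply]
  exact Finset.single_le_sum (f := fun i => (X.stieltjes i).variation s) (fun _ _ => zero_le)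
    (Finset.mem_univ i)

theorem domMeasure_univ_le (X : BVPath d) : X.domMeasure univ ≤ d * (2 * X.tv) := by
  rw [domMeasure, Measure.finsetSum_apply]
  refine (Finset.sum_le_card_nsmul _ _ (2 * X.tv) fun i _ => ?_).trans (by simp)
  exact (BoundedVariationOn.vectorMeasure_variation_univ_le _).trans
    (by gcongr; exact X.coord_eVariationOn_le i)

theorem enorm_iterInt_succ_le (X : BVPath d) {k : ℕ} (w : Fin (k + 1) → Fin d) (s : Set I) :
    ‖X.iterInt (k + 1) w s‖ₑ ≤ ∫⁻ u in s, ‖X.iterInt k (Fin.init w) (Iio u)‖ₑ ∂X.domMeasure := by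
  rw [iterInt]
  refine (VectorMeasure.enorm_setIntegral_le_lintegral_enorm_transpose).trans ?_
  rw [VectorMeasure.variation_transpose_lsmul]
  exact lintegral_mono' (Measure.restrict_mono le_rfl (X.variation_le_domMeasure _)) le_rfl

theorem enorm_iterInt_Iio_le (X : BVPath d) (k : ℕ) (w : Fin k → Fin d) (t : I) :
    ‖X.iterInt k w (Iio t)‖ₑ ≤ simplexMass X.domMeasure k t := by
  induction k generalizing t with
  | zero => simp [iterInt, simplexMass]
  | succ k ih =>
    exact (X.enorm_iterInt_succ_le w _).trans (lintegral_mono fun u => ih _ u)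

theorem enorm_iterInt_Iio_le_pow (X : BVPath d) (k : ℕ) (w : Fin k → Fin d) (t : I) :
    (k.factorial : ENNReal) * ‖X.iterInt k w (Iio t)‖ₑ ≤ X.domMeasure univ ^ k :=
  (mul_le_mul_right (X.enorm_iterInt_Iio_le k w t) _).trans (factorial_mul_simplexMass_le _ k t)

theorem norm_iterInt_Iio_le (X : BVPath d) (k : ℕ) (w : Fin k → Fin d) (t : I) :
    ‖X.iterInt k w (Iio t)‖ ≤ X.domMeasure.real univ ^ k := by
  have h : ‖X.iterInt k w (Iio t)‖ₑ ≤ X.domMeasure univ ^ k := by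
    refine le_trans ?_ (X.enorm_iterInt_Iio_le_pow k w t)
    refine le_mul_of_one_le_left zero_le ?_
    exact_mod_cast k.factorial_pos
  have := ENNReal.toReal_mono (by finiteness) h
  simpa [Measure.real] using this

/-- The outermost integral runs over all of `[0,1]`, including a possible atom at `1`, so only the
`k` inner integrals contribute to the factorial. This is still summable over words. -/
theorem abs_sigCoeff_succ_le (X : BVPath d) {k : ℕ} (w : Fin (k + 1) → Fin d) {c : ℝ}
    (hc : X.domMeasure.real univ ≤ c) :
    |X.sigCoeff w| ≤ c ^ (k + 1) / k.factorial := by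
  have h : (k.factorial : ENNReal) * ‖X.sigCoeff w‖ₑ ≤ X.domMeasure univ ^ (k + 1) := by
    calc (k.factorial : ENNReal) * ‖X.sigCoeff w‖ₑ
        ≤ k.factorial * ∫⁻ u in univ, ‖X.iterInt k (Fin.init w) (Iio u)‖ₑ ∂X.domMeasure :=
          mul_le_mul_right (X.enorm_iterInt_succ_le w univ) _
      _ = ∫⁻ u, k.factorial * ‖X.iterInt k (Fin.init w) (Iio u)‖ₑ ∂X.domMeasure := by
          rw [Measure.restrict_univ, lintegral_const_mul' _ _ (by finiteness)]
      _ ≤ ∫⁻ _, X.domMeasure univ ^ k ∂X.domMeasure :=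
          lintegral_mono fun u => X.enorm_iterInt_Iio_le_pow k _ u
      _ = X.domMeasure univ ^ (k + 1) := by rw [lintegral_const, pow_succ]
  have := ENNReal.toReal_mono (by finiteness) h
  rw [le_div_iff₀ (by positivity), mul_comm]
  refine le_trans ?_ (pow_le_pow_left₀ (by positivity) hc _)
  simpa [Measure.real] using this

/-- As `t` increases to `u`, the indicators of `Iio t` converge pointwise to that of `Iio u`, and
dominated convergence applies. The strict inequalities in the simplex give left-continuity, hence
measurability of the next integrand. -/
theorem continuousWithinAt_Iic_iterInt_Iio (X : BVPath d) (k : ℕ) (w : Fin k → Fin d) (u : I) :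
    ContinuousWithinAt (fun t => X.iterInt k w (Iio t)) (Iic u) u := by
  induction k generalizing u with
  | zero => exact continuousWithinAt_const
  | succ k ih =>
    have hm := measurable_of_forall_continuousWithinAt_Iic (ih (Fin.init w))
    simp only [iterInt, ← VectorMeasure.integral_indicator measurableSet_Iio]
    refine VectorMeasure.tendsto_integral_filter_of_norm_le_const
      (Eventually.of_forall fun t => (hm.indicator measurableSet_Iio).aestronglyMeasurable)
      ⟨X.domMeasure.real univ ^ k, Eventually.of_forall fun t => Eventually.of_forall fun v =>
        (norm_indicator_le_norm_self _ _).trans (X.norm_iterInt_Iio_le k _ v)⟩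
      (Eventually.of_forall fun v => ?_)
    refine tendsto_const_nhds.congr' ?_
    rcases lt_or_ge v u with h | h
    · filter_upwards [mem_nhdsWithin_of_mem_nhds (Ioi_mem_nhds h)] with t ht
      rw [indicator_of_mem (mem_Iio.2 h), indicator_of_mem (mem_Iio.2 ht)]
    · filter_upwards [self_mem_nhdsWithin] with t ht
      rw [indicator_of_notMem (by simpa using h), indicator_of_notMem (by simpa using ht.trans h)]

theorem measurable_coord_apply (i : Fin d) (t : I) : Measurable fun X : BVPath d => X.coord i t :=
  ((EuclideanSpace.proj (𝕜 := ℝ) i).continuous.measurable).comp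
    ((measurable_pi_apply t).comp measurable_subtype_coe)

theorem measurable_leftLim_coord (i : Fin d) (t : I) :
    Measurable fun X : BVPath d => (X.coord i).leftLim t := by
  by_cases h : ∃ b, b < t
  · obtain ⟨b, hb⟩ := h
    obtain ⟨u, -, hu, hlim⟩ := exists_seq_strictMono_tendsto' hb
    refine measurable_of_tendsto_metrizable (fun n => measurable_coord_apply i (u n))
      (tendsto_pi_nhds.2 fun X => ?_)
    exact ((X.coord_boundedVariationOn i).tendsto_leftLim t).comp
      (tendsto_nhdsWithin_of_tendsto_nhds_of_eventually_within _ hlim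
        (Eventually.of_forall fun n => (hu n).2))
  · have ht : IsBot t := by simpa [IsBot] using h
    simp only [leftLim_eq_of_isBot ht]
    exact measurable_coord_apply i t

/-- The masses of the intervals `Iio a`, a generating π-system, are left limits minus the initial
value, and left limits are limits of evaluations along a sequence. -/
theorem measurable_stieltjes_apply (i : Fin d) (s : Set I) :
    Measurable fun X : BVPath d => X.stieltjes i s := by
  have hbot : ∀ X : BVPath d, limUnder atBot (X.coord i) = X.coord i 0 := fun X => by
    rw [atBot_eq_pure_of_isBot (x := (0 : I)) fun x => x.2.1]
    exact (tendsto_pure_nhds _ _).limUnder_eq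
  have htop : ∀ X : BVPath d, limUnder atTop (X.coord i) = X.coord i 1 := fun X => by
    rw [atTop_eq_pure_of_isTop (x := (1 : I)) fun x => x.2.2]
    exact (tendsto_pure_nhds _ _).limUnder_eq
  have huniv : Measurable fun X : BVPath d => X.stieltjes i univ := by
    simp only [stieltjes, BoundedVariationOn.vectorMeasure_univ, hbot, htop]
    exact (measurable_coord_apply i 1).sub (measurable_coord_apply i 0)
  by_cases hs : MeasurableSet s
  swap
  · simp only [VectorMeasure.not_measurable _ hs]
    exact measurable_const
  induction s, hs using MeasurableSpace.induction_on_inter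
    ((BorelSpace.measurable_eq (α := I)).trans (borel_eq_generateFrom_Iio I)) isPiSystem_Iio with
  | empty => simp
  | basic t ht =>
    obtain ⟨a, rfl⟩ := ht
    simp only [stieltjes, BoundedVariationOn.vectorMeasure_Iio, hbot]
    exact (measurable_leftLim_coord i a).sub (measurable_coord_apply i 0)
  | compl t htm iht =>
    simp only [VectorMeasure.of_compl htm]
    exact huniv.sub iht
  | iUnion f hfd hfm ihf =>
    refine measurable_of_tendsto_metrizable
      (fun n => Finset.measurable_sum (Finset.range n) fun j _ => ihf j)
      (tendsto_pi_nhds.2 fun X => ?_)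
    simpa using ((X.stieltjes i).m_iUnion hfm hfd).tendsto_sum_nat

/-- Freezing the inner integral at grid points turns the outer one into a finite sum of products of
measurable functions of the path; left-continuity and dominated convergence give the limit. -/
theorem measurable_iterInt (k : ℕ) (w : Fin k → Fin d) {s : Set I} (hs : MeasurableSet s) :
    Measurable fun X : BVPath d => X.iterInt k w s := by
  induction k generalizing s with
  | zero => exact measurable_const
  | succ k ih =>
    have hlim : ∀ X : BVPath d, Tendsto (fun n => ∑ j ∈ Finset.range (n + 2),
        X.iterInt k (Fin.init w) (Iio (gridPoint n j)) *
          X.stieltjes (w (Fin.last k)) (gridIndex n ⁻¹' {j} ∩ s))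
        atTop (𝓝 (X.iterInt (k + 1) w s)) := by
      intro X
      have h : Tendsto (fun n => ∫ᵛ u in s, X.iterInt k (Fin.init w)
          (Iio (gridPoint n (gridIndex n u))) ∂•(X.stieltjes (w (Fin.last k)))) atTop
          (𝓝 (X.iterInt (k + 1) w s)) := VectorMeasure.tendsto_integral_filter_of_norm_le_const
        (Eventually.of_forall fun n => (measurable_comp_grid
          (fun t => X.iterInt k (Fin.init w) (Iio t)) n).aestronglyMeasurable)
        ⟨X.domMeasure.real univ ^ k, Eventually.of_forall fun n => Eventually.of_forall fun v =>
          X.norm_iterInt_Iio_le k _ _⟩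
        (Eventually.of_forall fun v =>
          tendsto_comp_grid (X.continuousWithinAt_Iic_iterInt_Iio k (Fin.init w) v))
      refine h.congr fun n => ?_
      rw [comp_grid_eq_sum_indicator (fun t => X.iterInt k (Fin.init w) (Iio t)) n,
        VectorMeasure.integral_finsetSum]
      · refine Finset.sum_congr rfl fun j _ => ?_
        have hj : MeasurableSet (gridIndex n ⁻¹' {j}) :=
          measurable_gridIndex n (measurableSet_singleton j)
        rw [VectorMeasure.integral_indicator_const _ hj, VectorMeasure.restrict_apply _ hs hj]
        simp
      · intro j _
        exact (integrable_const _).indicator (measurable_gridIndex n (measurableSet_singleton j))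
    refine measurable_of_tendsto_metrizable (fun n => ?_) (tendsto_pi_nhds.2 hlim)
    exact Finset.measurable_sum _ fun j _ =>
      (ih _ measurableSet_Iio).mul (measurable_stieltjes_apply _ _)

theorem measurable_sigCoeff {k : ℕ} (w : Fin k → Fin d) :
    Measurable fun X : BVPath d => X.sigCoeff w :=
  measurable_iterInt k w MeasurableSet.univ

end SigReg.BVPath

/-! ### Uniform boundedness of truncated signatures. -/

namespace SigReg

variable {d : ℕ}

theorem measurable_truncSig (m : ℕ) : Measurable (truncSig (d := d) m) :=
  (PiLp.continuous_toLp 2 _).measurable.comp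
    (measurable_pi_lambda _ fun w => BVPath.measurable_sigCoeff w.2)

theorem norm_truncSig_sq (m : ℕ) (X : BVPath d) :
    ‖truncSig m X‖ ^ 2 = ∑ k ∈ Finset.range (m + 1), ∑ w : Fin k → Fin d, X.sigCoeff w ^ 2 := by
  rw [EuclideanSpace.norm_sq_eq, Fintype.sum_sigma, Finset.sum_range]
  simp [truncSig]

/-- The truncated signatures of the paths of total variation at most `K` are bounded, uniformly
in the truncation order. -/
theorem exists_norm_truncSig_sq_le (d : ℕ) (K : ℝ) :
    ∃ C : ℝ, ∀ (m : ℕ) (X : BVPath d), X.tv ≤ ENNReal.ofReal K → ‖truncSig m X‖ ^ 2 ≤ C := by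
  obtain ⟨c, hc⟩ : ∃ c : ℝ, c = d * (2 * max K 0) := ⟨_, rfl⟩
  have hc0 : 0 ≤ c := by rw [hc]; positivity
  refine ⟨1 + d * c ^ 2 * Real.exp (d * c ^ 2), fun m X hX => ?_⟩
  have hdom : X.domMeasure.real Set.univ ≤ c := by
    have := ENNReal.toReal_mono (by finiteness)
      (X.domMeasure_univ_le.trans (mul_le_mul_right (mul_le_mul_right hX 2) d))
    simpa [Measure.real, hc, ENNReal.toReal_ofReal'] using this
  rw [norm_truncSig_sq, Finset.sum_range_succ']
  have h0 : ∑ w : Fin 0 → Fin d, X.sigCoeff w ^ 2 = 1 := by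
    simp [BVPath.sigCoeff, BVPath.iterInt]
  rw [h0, add_comm]
  gcongr
  -- Of the squared factorial, one factor is enough: with the `d^(k+1)` words of length `k + 1` it
  -- leaves an exponential series.
  calc ∑ k ∈ Finset.range m, ∑ w : Fin (k + 1) → Fin d, X.sigCoeff w ^ 2
      ≤ ∑ k ∈ Finset.range m, d * c ^ 2 * ((d * c ^ 2) ^ k / k.factorial) := by
        refine Finset.sum_le_sum fun k _ => ?_
        calc ∑ w : Fin (k + 1) → Fin d, X.sigCoeff w ^ 2
            ≤ ∑ _w : Fin (k + 1) → Fin d, (c ^ (k + 1)) ^ 2 / k.factorial := by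
              refine Finset.sum_le_sum fun w _ => ?_
              have h1 := X.abs_sigCoeff_succ_le w hdom
              have h2 : (1 : ℝ) ≤ k.factorial := by exact_mod_cast k.factorial_pos
              calc X.sigCoeff w ^ 2 = |X.sigCoeff w| ^ 2 := (sq_abs _).symm
                _ ≤ (c ^ (k + 1) / k.factorial) ^ 2 := by gcongr
                _ = (c ^ (k + 1)) ^ 2 / (k.factorial : ℝ) ^ 2 := div_pow _ _ _
                _ ≤ (c ^ (k + 1)) ^ 2 / k.factorial := by
                  gcongr
                  nlinarith
          _ = d * c ^ 2 * ((d * c ^ 2) ^ k / k.factorial) := by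
              simp only [Finset.sum_const, Finset.card_univ, Fintype.card_pi, Fintype.card_fin,
                Finset.prod_const, nsmul_eq_mul, Nat.cast_pow]
              ring
    _ = d * c ^ 2 * ∑ k ∈ Finset.range m, (d * c ^ 2) ^ k / k.factorial := by
        rw [Finset.mul_sum]
    _ ≤ d * c ^ 2 * Real.exp (d * c ^ 2) := by
        gcongr
        exact Real.sum_le_exp_of_nonneg (by positivity) m

end SigReg

/-! ### Cauchy–Schwarz for linear and quadratic forms. -/

section EuclideanForms

variable {W : Type*} [Fintype W]

theorem EuclideanSpace.real_inner_eq_sum_mul (x y : EuclideanSpace ℝ W) :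
    inner ℝ x y = ∑ w, x w * y w := by
  simp [PiLp.inner_apply, mul_comm]

/-- The quadratic form with matrix `G`. -/
def quadForm (G : W × W → ℝ) (γ : EuclideanSpace ℝ W) : ℝ := ∑ p, γ p.1 * γ p.2 * G p

theorem inner_sq_eq_quadForm (γ s : EuclideanSpace ℝ W) :
    inner ℝ γ s ^ 2 = quadForm (fun p => s p.1 * s p.2) γ := by
  rw [EuclideanSpace.real_inner_eq_sum_mul, sq, Finset.sum_mul_sum, quadForm,
    Fintype.sum_prod_type]
  exact Finset.sum_congr rfl fun w _ => Finset.sum_congr rfl fun v _ => by ring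

theorem sum_sq_mul_self_eq_norm (γ : EuclideanSpace ℝ W) :
    ∑ p : W × W, (γ p.1 * γ p.2) ^ 2 = (‖γ‖ ^ 2) ^ 2 := by
  rw [EuclideanSpace.real_norm_sq_eq, sq (∑ i, γ i ^ 2), Finset.sum_mul_sum,
    Fintype.sum_prod_type]
  exact Finset.sum_congr rfl fun w _ => Finset.sum_congr rfl fun v _ => by ring

/-- The Hilbert–Schmidt norm replaces the operator norm because its mean square is a sum of
variances. -/
theorem abs_quadForm_le (G : W × W → ℝ) (γ : EuclideanSpace ℝ W) :
    |quadForm G γ| ≤ ‖γ‖ ^ 2 * √(∑ p, G p ^ 2) := by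
  refine abs_le_of_sq_le_sq ?_ (by positivity)
  rw [mul_pow, Real.sq_sqrt (by positivity), ← sum_sq_mul_self_eq_norm]
  exact Finset.sum_mul_sq_le_sq_mul_sq _ _ _

theorem abs_sum_mul_le_norm_mul_sqrt (γ : EuclideanSpace ℝ W) (a : W → ℝ) :
    |∑ w, γ w * a w| ≤ ‖γ‖ * √(∑ w, a w ^ 2) := by
  refine abs_le_of_sq_le_sq ?_ (by positivity)
  rw [mul_pow, Real.sq_sqrt (by positivity), EuclideanSpace.real_norm_sq_eq]
  exact Finset.sum_mul_sq_le_sq_mul_sq _ _ _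

theorem quadForm_le_add (G H : W × W → ℝ) (γ : EuclideanSpace ℝ W) :
    quadForm G γ ≤ quadForm H γ + ‖γ‖ ^ 2 * √(∑ p, (H p - G p) ^ 2) := by
  have h : quadForm G γ = quadForm H γ - quadForm (fun p => H p - G p) γ := by
    simp only [quadForm, ← Finset.sum_sub_distrib]
    exact Finset.sum_congr rfl fun p _ => by ring
  have := neg_le_of_abs_le (abs_quadForm_le (fun p => H p - G p) γ)
  linarith

end EuclideanForms

/-! ### Mean-square deviations, independence, measurable selection of an index. -/

section Probability

variable {Ω : Type*} [MeasurableSpace Ω] {P : Measure Ω} [IsProbabilityMeasure P]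

theorem integral_sqrt_le_sqrt_integral {F : Ω → ℝ} (hF : Integrable F P) (h0 : 0 ≤ F) :
    ∫ ω, √(F ω) ∂P ≤ √(∫ ω, F ω ∂P) := by
  have hm : AEStronglyMeasurable (fun ω => √(F ω)) P :=
    Real.continuous_sqrt.comp_aestronglyMeasurable hF.aestronglyMeasurable
  have hsq : (fun ω => √(F ω)) ^ 2 = F := by
    ext ω
    exact Real.sq_sqrt (h0 ω)
  have hL : MemLp (fun ω => √(F ω)) 2 P := by
    rw [memLp_two_iff_integrable_sq hm]
    exact hF.congr (Eventually.of_forall fun ω => (Real.sq_sqrt (h0 ω)).symm)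
  -- Jensen's inequality for the square root is nonnegativity of a variance.
  have h := variance_nonneg (fun ω => √(F ω)) P
  rw [variance_eq_sub hL, hsq] at h
  exact Real.le_sqrt_of_sq_le (by linarith)

/-- The empirical mean of `n` i.i.d. square integrable variables has mean square error at most
the second moment divided by `n`. -/
theorem integral_sq_mean_sub_le {E : Type*} [MeasurableSpace E] {Z : Ω → E} {Zs : ℕ → Ω → E}
    (hident : ∀ i, IdentDistrib (Zs i) Z P P) (hindep : iIndepFun Zs P) {g : E → ℝ}
    (hg : Measurable g) (hL : MemLp (fun ω => g (Z ω)) 2 P) {n : ℕ} (hn : 0 < n) :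
    Integrable (fun ω => (1 / (n : ℝ) * ∑ i : Fin n, g (Zs i ω) - ∫ ω, g (Z ω) ∂P) ^ 2) P ∧
    ∫ ω, (1 / (n : ℝ) * ∑ i : Fin n, g (Zs i ω) - ∫ ω, g (Z ω) ∂P) ^ 2 ∂P
      ≤ (∫ ω, g (Z ω) ^ 2 ∂P) / n := by
  have hn' : (n : ℝ) ≠ 0 := by positivity
  have hid : ∀ i, IdentDistrib (fun ω => g (Zs i ω)) (fun ω => g (Z ω)) P P :=
    fun i => (hident i).comp hg
  have hLi : ∀ i, MemLp (fun ω => g (Zs i ω)) 2 P := fun i => (hid i).symm.memLp_snd hL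
  have hLs : MemLp (∑ i : Fin n, fun ω => g (Zs i ω)) 2 P :=
    memLp_finsetSum' _ fun i _ => hLi i
  have hLm : MemLp (fun ω => 1 / (n : ℝ) * (∑ i : Fin n, fun ω => g (Zs i ω)) ω) 2 P :=
    hLs.const_mul _
  have hmean : ∫ ω, 1 / (n : ℝ) * (∑ i : Fin n, fun ω => g (Zs i ω)) ω ∂P = ∫ ω, g (Z ω) ∂P := by
    simp only [Finset.sum_apply]
    rw [integral_const_mul, integral_finsetSum _ fun (i : Fin n) _ => (hLi i).integrable one_le_two]
    simp only [fun i => (hid i).integral_eq, Finset.sum_const, Finset.card_univ,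
      Fintype.card_fin, nsmul_eq_mul]
    field_simp
  constructor
  · have := (hLm.sub (memLp_const (∫ ω, g (Z ω) ∂P))).integrable_sq
    simpa using this
  · have hsum : Var[∑ i : Fin n, fun ω => g (Zs i ω); P]
        = ∑ i : Fin n, Var[fun ω => g (Zs i ω); P] :=
      IndepFun.variance_sum (fun i _ => hLi i) fun i _ j _ hij =>
        IndepFun.comp (φ := g) (ψ := g) (hindep.indepFun (Fin.val_ne_of_ne hij)) hg hg
    have hvar := variance_eq_integral (μ := P) hLm.aemeasurable
    rw [hmean, variance_const_mul, hsum] at hvar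
    simp only [fun i => (hid i).variance_eq, Finset.sum_const, Finset.card_univ,
      Fintype.card_fin, nsmul_eq_mul, Finset.sum_apply] at hvar
    rw [← hvar]
    have := variance_le_expectation_sq (μ := P) hL.aestronglyMeasurable
    simp only [Pi.pow_apply] at this
    rw [le_div_iff₀ (by positivity)]
    calc _ = Var[fun ω => g (Z ω); P] := by field_simp
      _ ≤ _ := this

/-- Variances are summed over coordinates before being bounded, so only the squared norm of the
whole vector enters, not the size of `J`. This makes the rate uniform in the truncation order. -/
theorem integral_sqrt_sum_sq_mean_sub_le {E : Type*} [MeasurableSpace E] {Z : Ω → E}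
    {Zs : ℕ → Ω → E} (hident : ∀ i, IdentDistrib (Zs i) Z P P) (hindep : iIndepFun Zs P)
    {J : Type*} [Fintype J] {g : J → E → ℝ} (hg : ∀ j, Measurable (g j))
    (hL : ∀ j, MemLp (fun ω => g j (Z ω)) 2 P) {C : ℝ}
    (hC : ∀ᵐ ω ∂P, ∑ j, g j (Z ω) ^ 2 ≤ C) {n : ℕ} (hn : 0 < n) :
    Integrable (fun ω =>
      √(∑ j, (1 / (n : ℝ) * ∑ i : Fin n, g j (Zs i ω) - ∫ ω, g j (Z ω) ∂P) ^ 2)) P ∧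
    ∫ ω, √(∑ j, (1 / (n : ℝ) * ∑ i : Fin n, g j (Zs i ω) - ∫ ω, g j (Z ω) ∂P) ^ 2) ∂P
      ≤ √(C / n) := by
  have h := fun j => integral_sq_mean_sub_le hident hindep (hg j) (hL j) hn
  have hint := integrable_finsetSum Finset.univ fun j _ => (h j).1
  have h0 : 0 ≤ fun ω =>
      ∑ j, (1 / (n : ℝ) * ∑ i : Fin n, g j (Zs i ω) - ∫ ω, g j (Z ω) ∂P) ^ 2 :=
    fun ω => Finset.sum_nonneg fun j _ => sq_nonneg _
  refine ⟨?_, (integral_sqrt_le_sqrt_integral hint h0).trans (Real.sqrt_le_sqrt ?_)⟩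
  · have hm := Real.continuous_sqrt.comp_aestronglyMeasurable hint.aestronglyMeasurable
    have hL2 : MemLp (fun ω =>
        √(∑ j, (1 / (n : ℝ) * ∑ i : Fin n, g j (Zs i ω) - ∫ ω, g j (Z ω) ∂P) ^ 2)) 2 P := by
      rw [memLp_two_iff_integrable_sq hm]
      exact hint.congr (Eventually.of_forall fun ω => (Real.sq_sqrt (h0 ω)).symm)
    exact hL2.integrable one_le_two
  · rw [integral_finsetSum _ fun j _ => (h j).1]
    calc ∑ j, ∫ ω, (1 / (n : ℝ) * ∑ i : Fin n, g j (Zs i ω) - ∫ ω, g j (Z ω) ∂P) ^ 2 ∂P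
        ≤ ∑ j, (∫ ω, g j (Z ω) ^ 2 ∂P) / n := Finset.sum_le_sum fun j _ => (h j).2
      _ = (∫ ω, ∑ j, g j (Z ω) ^ 2 ∂P) / n := by
        rw [← Finset.sum_div, integral_finsetSum _ fun j _ => (hL j).integrable_sq]
      _ ≤ C / n := by
        gcongr
        calc ∫ ω, ∑ j, g j (Z ω) ^ 2 ∂P ≤ ∫ _, C ∂P :=
              integral_mono_ae (integrable_finsetSum _ fun j _ => (hL j).integrable_sq)
                (integrable_const _) hC
          _ = C := by simp

theorem EuclideanSpace.abs_apply_le_norm {W : Type*} [Fintype W] (γ : EuclideanSpace ℝ W) (w : W) :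
    |γ w| ≤ ‖γ‖ := by
  simpa using PiLp.norm_apply_le γ w

/-- The second moment of `⟨Γ, S⟩` for independent bounded random vectors. -/
theorem integral_inner_sq_of_indepFun {W : Type*} [Fintype W] {Γ S : Ω → EuclideanSpace ℝ W}
    (hΓ : Measurable Γ) (hS : Measurable S) {a b : ℝ} (ha : ∀ ω, ‖Γ ω‖ ≤ a)
    (hb : ∀ᵐ ω ∂P, ‖S ω‖ ≤ b) (hind : IndepFun Γ S P) :
    ∫ ω, inner ℝ (Γ ω) (S ω) ^ 2 ∂P
      = ∫ ω, quadForm (fun p => ∫ ω, S ω p.1 * S ω p.2 ∂P) (Γ ω) ∂P := by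
  have hm : ∀ p : W × W, Measurable fun x : EuclideanSpace ℝ W => x p.1 * x p.2 := fun p =>
    ((EuclideanSpace.proj (𝕜 := ℝ) p.1).continuous.mul
      (EuclideanSpace.proj (𝕜 := ℝ) p.2).continuous).measurable
  have hbd : ∀ (x : EuclideanSpace ℝ W) (c : ℝ) (p : W × W), ‖x‖ ≤ c →
      ‖x p.1 * x p.2‖ ≤ c * c := fun x c p hx => by
    rw [norm_mul]
    have h1 := (EuclideanSpace.abs_apply_le_norm x p.1).trans hx
    have h2 := (EuclideanSpace.abs_apply_le_norm x p.2).trans hx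
    exact mul_le_mul h1 h2 (abs_nonneg _) ((abs_nonneg _).trans h1)
  have hΓp : ∀ p : W × W, Integrable (fun ω => Γ ω p.1 * Γ ω p.2) P := fun p =>
    Integrable.of_bound ((hm p).comp hΓ).aestronglyMeasurable (a * a)
      (Eventually.of_forall fun ω => hbd _ _ p (ha ω))
  have hSp : ∀ p : W × W, Integrable (fun ω => S ω p.1 * S ω p.2) P := fun p =>
    Integrable.of_bound ((hm p).comp hS).aestronglyMeasurable (b * b)
      (hb.mono fun ω h => hbd _ _ p h)
  have hip : ∀ p : W × W, IndepFun (fun ω => Γ ω p.1 * Γ ω p.2) (fun ω => S ω p.1 * S ω p.2) P :=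
    fun p => hind.comp (hm p) (hm p)
  have hip' : ∀ p : W × W,
      Integrable (fun ω => Γ ω p.1 * Γ ω p.2 * (S ω p.1 * S ω p.2)) P :=
    fun p => (hip p).integrable_mul (hΓp p) (hSp p)
  simp only [inner_sq_eq_quadForm, quadForm]
  rw [integral_finsetSum _ fun p _ => hip' p,
    integral_finsetSum _ fun p _ => (hΓp p).mul_const _]
  refine Finset.sum_congr rfl fun p _ => ?_
  rw [integral_mul_const]
  exact (hip p).integral_mul_eq_mul_integral (hΓp p).aestronglyMeasurable
    (hSp p).aestronglyMeasurable

theorem measurable_sInf_nat {α : Type*} [MeasurableSpace α] {p : ℕ → α → Prop}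
    (hp : ∀ m, MeasurableSet {x | p m x}) : Measurable fun x => sInf {m | p m x} := by
  refine measurable_of_Iic fun k => ?_
  -- Since `sInf ∅ = 0`, the points with no admissible index lie in every such preimage.
  have : (fun x => sInf {m | p m x}) ⁻¹' Set.Iic k
      = (⋃ j ∈ Set.Iic k, {x | p j x}) ∪ ⋂ j, {x | p j x}ᶜ := by
    ext x
    simp only [Set.mem_preimage, Set.mem_Iic, Set.mem_union, Set.mem_iUnion, Set.mem_ofPred_eq,
      exists_prop, Set.mem_iInter, Set.mem_compl_iff]
    constructor
    · intro h
      by_cases hne : ∃ m, p m x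
      · exact Or.inl ⟨_, h, Nat.sInf_mem (s := {m | p m x}) hne⟩
      · exact Or.inr (not_exists.1 hne)
    · rintro (⟨j, hj, hpj⟩ | h)
      · exact (Nat.sInf_le (s := {m | p m x}) hpj).trans hj
      · have : {m | p m x} = ∅ := by ext m; simpa using h m
        simp [this]
  rw [this]
  exact (MeasurableSet.biUnion (Set.to_countable _) fun j _ => hp j).union
    (MeasurableSet.iInter fun j => (hp j).compl)

end Probability

namespace SigReg

variable {d : ℕ}

/-! ### Comparing coefficient vectors of different orders. -/

section Padding

/-- Extension by zero of a coefficient vector of order `m` to order `M`. -/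
noncomputable def pad {m : ℕ} (M : ℕ) (β : Coeff d m) : Coeff d M :=
  WithLp.toLp 2 fun w => if h : (w.1 : ℕ) < m + 1 then β ⟨⟨w.1, h⟩, w.2⟩ else 0

/-- A general `F` vanishing at `0` covers both inner products and norms. -/
theorem sum_pad {m M : ℕ} (hm : m ≤ M) (β : Coeff d m)
    (F : (k : ℕ) → (Fin k → Fin d) → ℝ → ℝ) (hF : ∀ k w, F k w 0 = 0) :
    ∑ w, F w.1 w.2 (pad M β w) = ∑ w, F w.1 w.2 (β w) := by
  have h1 : ∑ w, F w.1 w.2 (pad M β w) = ∑ k ∈ Finset.range (M + 1), ∑ w : Fin k → Fin d,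
      F k w (if h : k < m + 1 then β ⟨⟨k, h⟩, w⟩ else 0) := by
    rw [Fintype.sum_sigma, Finset.sum_range]
    rfl
  have h2 : ∑ w, F w.1 w.2 (β w) = ∑ k ∈ Finset.range (m + 1), ∑ w : Fin k → Fin d,
      F k w (if h : k < m + 1 then β ⟨⟨k, h⟩, w⟩ else 0) := by
    rw [Fintype.sum_sigma, Finset.sum_range]
    exact Finset.sum_congr rfl fun k _ => Finset.sum_congr rfl fun w _ => by
      rw [dif_pos k.2]
  rw [h1, h2]
  refine (Finset.sum_subset (Finset.range_mono (by lia)) fun k _ hk => ?_).symm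
  refine Finset.sum_eq_zero fun w _ => ?_
  rw [dif_neg (by simpa using hk), hF]

theorem inner_pad_truncSig {m M : ℕ} (hm : m ≤ M) (β : Coeff d m) (X : BVPath d) :
    inner ℝ (pad M β) (truncSig M X) = inner ℝ β (truncSig m X) := by
  simp only [EuclideanSpace.real_inner_eq_sum_mul, truncSig]
  exact sum_pad hm β (fun k w x => x * X.sigCoeff w) fun k w => zero_mul _

theorem norm_pad {m M : ℕ} (hm : m ≤ M) (β : Coeff d m) : ‖pad M β‖ = ‖β‖ := by
  rw [← sq_eq_sq₀ (norm_nonneg _) (norm_nonneg _), EuclideanSpace.real_norm_sq_eq,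
    EuclideanSpace.real_norm_sq_eq]
  exact sum_pad hm β (fun k w x => x ^ 2) fun k w => by simp

theorem measurable_pad (m M : ℕ) : Measurable (pad (d := d) (m := m) M) := by
  refine (PiLp.continuous_toLp 2 _).measurable.comp (measurable_pi_lambda _ fun w => ?_)
  by_cases h : (w.1 : ℕ) < m + 1
  · simp only [h, dif_pos]
    exact (EuclideanSpace.proj (𝕜 := ℝ) _).continuous.measurable
  · simp only [h, dif_neg, not_false_eq_true]
    exact measurable_const

theorem norm_pad_sub_pad_le {m m' M : ℕ} (hm : m ≤ M) (hm' : m' ≤ M) {α : ℝ} {β : Coeff d m}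
    {β' : Coeff d m'} (hβ : ‖β‖ ≤ α) (hβ' : ‖β'‖ ≤ α) : ‖pad M β - pad M β'‖ ≤ 2 * α := by
  refine (norm_sub_le _ _).trans ?_
  rw [norm_pad hm, norm_pad hm']
  linarith

theorem inner_pad_sub_pad_truncSig {m m' M : ℕ} (hm : m ≤ M) (hm' : m' ≤ M) (β : Coeff d m)
    (β' : Coeff d m') (X : BVPath d) :
    inner ℝ (pad M β - pad M β') (truncSig M X)
      = inner ℝ β (truncSig m X) - inner ℝ β' (truncSig m' X) := by
  rw [inner_sub_left, inner_pad_truncSig hm, inner_pad_truncSig hm']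

end Padding

/-! ### Empirical risk, penalty and the selected order. -/

section EmpiricalRisk

theorem empRisk_nonneg {n : ℕ} (D : Sample d n) (m : ℕ) (β : Coeff d m) : 0 ≤ empRisk D m β :=
  mul_nonneg (by positivity) (Finset.sum_nonneg fun _ _ => sq_nonneg _)

theorem IsERM.minEmpRisk_eq {α : ℝ} {n m : ℕ} {b : Sample d n → Coeff d m} (hb : IsERM α b)
    (D : Sample d n) : minEmpRisk α D m = empRisk D m (b D) := by
  have hmem : b D ∈ Metric.closedBall (0 : Coeff d m) α := by
    simpa using hb.norm_le D
  have : Nonempty (Metric.closedBall (0 : Coeff d m) α) := ⟨⟨b D, hmem⟩⟩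
  refine le_antisymm (ciInf_le ⟨0, ?_⟩ (⟨b D, hmem⟩ : Metric.closedBall (0 : Coeff d m) α))
    (le_ciInf fun β => hb.isMin D β (mem_closedBall_zero_iff.1 β.2))
  rintro _ ⟨β, rfl⟩
  exact empRisk_nonneg D m β

theorem minEmpRisk_nonneg (α : ℝ) {n : ℕ} (D : Sample d n) (m : ℕ) : 0 ≤ minEmpRisk α D m :=
  Real.iInf_nonneg fun β => empRisk_nonneg D m β

theorem pen_nonneg {Kpen : ℝ} (hK : 0 ≤ Kpen) (ρ : ℝ) (n m : ℕ) : 0 ≤ pen d Kpen ρ n m := by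
  unfold pen; positivity

theorem pen_mono {Kpen : ℝ} (hK : 0 ≤ Kpen) (ρ : ℝ) (n : ℕ) : Monotone (pen d Kpen ρ n) := by
  intro m m' h
  have : sigDim d m ≤ sigDim d m' :=
    Finset.sum_le_sum_of_subset (Finset.range_mono (by lia))
  unfold pen
  gcongr

theorem tendsto_pen_atTop (hd : 1 ≤ d) {Kpen : ℝ} (hK : 0 < Kpen) (ρ : ℝ) {n : ℕ} (hn : 0 < n) :
    Tendsto (pen d Kpen ρ n) atTop atTop := by
  refine Tendsto.const_mul_atTop (by positivity) ?_
  refine Real.tendsto_sqrt_atTop.comp (tendsto_natCast_atTop_atTop.comp ?_)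
  refine tendsto_atTop_mono (fun m => ?_) tendsto_id
  calc m ≤ ∑ k ∈ Finset.range (m + 1), 1 := by simp
    _ ≤ sigDim d m := Finset.sum_le_sum fun k _ => Nat.one_le_pow _ _ hd

theorem tendsto_pen_zero (Kpen : ℝ) {ρ : ℝ} (hρ : 0 < ρ) (m : ℕ) :
    Tendsto (fun n => pen d Kpen ρ n m) atTop (nhds 0) := by
  have := ((tendsto_rpow_neg_atTop hρ).comp tendsto_natCast_atTop_atTop).const_mul Kpen
  simpa [pen] using this.mul_const (√(sigDim d m : ℝ))

theorem mHat_le (hd : 1 ≤ d) (α : ℝ) {Kpen : ℝ} (hK : 0 < Kpen) (ρ : ℝ) {n : ℕ} (hn : 0 < n)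
    (D : Sample d n) (m : ℕ) :
    minEmpRisk α D (mHat α Kpen ρ D) + pen d Kpen ρ n (mHat α Kpen ρ D)
      ≤ minEmpRisk α D m + pen d Kpen ρ n m := by
  -- Coercivity of the penalty makes the set of minimizers nonempty, so its `sInf` is a minimizer.
  have ht : Tendsto (fun m => minEmpRisk α D m + pen d Kpen ρ n m) cofinite atTop := by
    rw [Nat.cofinite_eq_atTop]
    exact tendsto_atTop_mono (fun m => le_add_of_nonneg_left (minEmpRisk_nonneg α D m))
      (tendsto_pen_atTop hd hK ρ hn)
  exact Nat.sInf_mem (s := {m | ∀ m' : ℕ,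
    minEmpRisk α D m + pen d Kpen ρ n m ≤ minEmpRisk α D m' + pen d Kpen ρ n m'})
    ht.exists_forall_le m

theorem measurable_inner_truncSig {m : ℕ} :
    Measurable fun z : Coeff d m × BVPath d => (inner ℝ z.1 (truncSig m z.2) : ℝ) :=
  measurable_fst.inner ((measurable_truncSig m).comp measurable_snd)

theorem measurable_empRisk {n m : ℕ} {b : Sample d n → Coeff d m} (hb : Measurable b) :
    Measurable fun D : Sample d n => empRisk D m (b D) := by
  refine (Finset.measurable_sum _ fun i _ => Measurable.pow_const ?_ 2).const_mul _
  exact (measurable_snd.comp (measurable_pi_apply i)).sub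
    (measurable_inner_truncSig.comp (hb.prodMk (measurable_fst.comp (measurable_pi_apply i))))

theorem measurable_mHat {α : ℝ} (Kpen ρ : ℝ) {n : ℕ} {b : ∀ m, Sample d n → Coeff d m}
    (hb : ∀ m, IsERM α (b m)) : Measurable (mHat (d := d) (n := n) α Kpen ρ) := by
  refine measurable_sInf_nat fun m => ?_
  -- The infimum over an uncountable ball is replaced by the risk at a measurable minimizer.
  have : {D : Sample d n | ∀ m', minEmpRisk α D m + pen d Kpen ρ n m
      ≤ minEmpRisk α D m' + pen d Kpen ρ n m'}
      = ⋂ m', {D : Sample d n | empRisk D m (b m D) + pen d Kpen ρ n m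
        ≤ empRisk D m' (b m' D) + pen d Kpen ρ n m'} := by
    ext D
    simp [(hb _).minEmpRisk_eq]
  rw [this]
  exact MeasurableSet.iInter fun m' => measurableSet_le
    ((measurable_empRisk (hb m).measurable).add_const _)
    ((measurable_empRisk (hb m').measurable).add_const _)

theorem quadForm_mean {n : ℕ} {W : Type*} [Fintype W] (s : Fin n → EuclideanSpace ℝ W)
    (γ : EuclideanSpace ℝ W) :
    quadForm (fun p => 1 / (n : ℝ) * ∑ i, s i p.1 * s i p.2) γ
      = 1 / (n : ℝ) * ∑ i, inner ℝ γ (s i) ^ 2 := by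
  simp only [inner_sq_eq_quadForm, quadForm, Finset.mul_sum]
  rw [Finset.sum_comm]
  exact Finset.sum_congr rfl fun i _ => Finset.sum_congr rfl fun p _ => by ring

theorem sum_mul_mean {n : ℕ} {W : Type*} [Fintype W] (e : Fin n → ℝ)
    (s : Fin n → EuclideanSpace ℝ W) (γ : EuclideanSpace ℝ W) :
    ∑ w, γ w * (1 / (n : ℝ) * ∑ i, e i * s i w) = 1 / (n : ℝ) * ∑ i, e i * inner ℝ γ (s i) := by
  simp only [EuclideanSpace.real_inner_eq_sum_mul, Finset.mul_sum]
  rw [Finset.sum_comm]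
  exact Finset.sum_congr rfl fun i _ => Finset.sum_congr rfl fun p _ => by ring

/-- The difference of two empirical risks, in terms of the empirical second moments of the
signature and of its empirical correlation with the residuals. -/
theorem empRisk_sub_empRisk {n : ℕ} (D : Sample d n) {m m' M : ℕ} (hm : m ≤ M) (hm' : m' ≤ M)
    (β : Coeff d m) (β' : Coeff d m') :
    empRisk D m β - empRisk D m' β' =
      quadForm (fun p => 1 / (n : ℝ) * ∑ i, truncSig M (D i).1 p.1 * truncSig M (D i).1 p.2)
        (pad M β - pad M β') -
      2 * ∑ w, (pad M β - pad M β') w * (1 / (n : ℝ) *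
        ∑ i, ((D i).2 - inner ℝ β' (truncSig m' (D i).1)) * truncSig M (D i).1 w) := by
  rw [quadForm_mean fun i => truncSig M (D i).1,
    sum_mul_mean (fun i => (D i).2 - inner ℝ β' (truncSig m' (D i).1))
      fun i => truncSig M (D i).1]
  simp only [empRisk, inner_pad_sub_pad_truncSig hm hm', Finset.mul_sum, ← Finset.sum_sub_distrib]
  exact Finset.sum_congr rfl fun i _ => by ring

end EmpiricalRisk

/-! ### Orthogonality of residuals and the gap below the minimal order. -/

section Regression

theorem exists_ae_norm_truncSig_le {Ω : Type*} [MeasurableSpace Ω] {P : Measure Ω}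
    {X : Ω → BVPath d} {K : ℝ} (h : ∀ᵐ ω ∂P, (X ω).tv ≤ ENNReal.ofReal K) :
    ∃ B : ℝ, 0 ≤ B ∧ ∀ᵐ ω ∂P, ∀ m, ‖truncSig m (X ω)‖ ≤ B := by
  obtain ⟨C, hC⟩ := exists_norm_truncSig_sq_le d K
  exact ⟨√C, Real.sqrt_nonneg C, h.mono fun ω hω m => Real.le_sqrt_of_sq_le (hC m _ hω)⟩

variable {Ω : Type*} [MeasurableSpace Ω] {P : Measure Ω} [IsProbabilityMeasure P]
  {X : Ω → BVPath d} {Y : Ω → ℝ}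

theorem abs_inner_truncSig_le {m : ℕ} {β : Coeff d m} {α B : ℝ} {x : BVPath d} (hβ : ‖β‖ ≤ α)
    (hx : ‖truncSig m x‖ ≤ B) : |inner ℝ β (truncSig m x)| ≤ α * B :=
  (abs_real_inner_le_norm _ _).trans
    (mul_le_mul hβ hx (norm_nonneg _) ((norm_nonneg _).trans hβ))

theorem measurable_truncSig_apply {m : ℕ} (w : Word d m) :
    Measurable fun x : BVPath d => truncSig m x w :=
  (EuclideanSpace.proj (𝕜 := ℝ) w).continuous.measurable.comp (measurable_truncSig m)

theorem measurable_inner_truncSig_right {m : ℕ} (β : Coeff d m) :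
    Measurable fun x : BVPath d => (inner ℝ β (truncSig m x) : ℝ) :=
  measurable_const.inner (measurable_truncSig m)

/-- The residuals are uncorrelated with the signature. -/
theorem IsRegression.integral_residual_mul_eq_zero {m : ℕ} {β : Coeff d m}
    (h : IsRegression P X Y m β) (hX : Measurable X) (hY : Measurable Y) {B K : ℝ}
    (hB : ∀ᵐ ω ∂P, ∀ m, ‖truncSig m (X ω)‖ ≤ B) (hK : ∀ᵐ ω ∂P, |Y ω| ≤ K) {M : ℕ}
    (w : Word d M) :
    ∫ ω, (Y ω - inner ℝ β (truncSig m (X ω))) * truncSig M (X ω) w ∂P = 0 := by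
  have hle : MeasurableSpace.comap X inferInstance ≤ (inferInstance : MeasurableSpace Ω) :=
    hX.comap_le
  have hSm := (measurable_truncSig_apply w).comp hX
  have hS : ∀ᵐ ω ∂P, ‖truncSig M (X ω) w‖ ≤ B :=
    hB.mono fun ω hω => (PiLp.norm_apply_le _ w).trans (hω M)
  have hYi : Integrable Y P := Integrable.of_bound hY.aestronglyMeasurable K hK
  have hf : Integrable (fun ω => (inner ℝ β (truncSig m (X ω)) : ℝ)) P :=
    Integrable.of_bound ((measurable_inner_truncSig_right β).comp hX).aestronglyMeasurable
      (‖β‖ * B) (hB.mono fun ω hω => abs_inner_truncSig_le le_rfl (hω m))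
  have hYS : Integrable (fun ω => Y ω * truncSig M (X ω) w) P :=
    hYi.mul_bdd hSm.aestronglyMeasurable hS
  have hfS : Integrable (fun ω => inner ℝ β (truncSig m (X ω)) * truncSig M (X ω) w) P :=
    hf.mul_bdd hSm.aestronglyMeasurable hS
  have hpull := condExp_mul_of_stronglyMeasurable_right (μ := P)
    (m := MeasurableSpace.comap X inferInstance) (f := Y) (g := fun ω => truncSig M (X ω) w)
    ((measurable_truncSig_apply w).comp (comap_measurable X)).stronglyMeasurable hYS hYi
  simp only [sub_mul]
  rw [integral_sub hYS hfS, sub_eq_zero]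
  calc ∫ ω, Y ω * truncSig M (X ω) w ∂P
      = ∫ ω, (P[Y * fun ω => truncSig M (X ω) w | MeasurableSpace.comap X inferInstance]) ω ∂P :=
        (integral_condExp hle).symm
    _ = _ := by
        refine integral_congr_ae ?_
        filter_upwards [hpull, h] with ω h1 h2
        rw [h1, Pi.mul_apply, h2]

/-- Below the minimal order, the excess risk is bounded away from zero on balls. -/
theorem exists_pos_le_excess_risk (hX : Measurable X) {B α : ℝ}
    (hB : ∀ᵐ ω ∂P, ∀ m, ‖truncSig m (X ω)‖ ≤ B) {mstar : ℕ}
    (hmin : ∀ m, (∃ β, IsRegression P X Y m β) → mstar ≤ m) {βstar : Coeff d mstar}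
    (hβstar : IsRegression P X Y mstar βstar) (hα : 0 ≤ α) (hβα : ‖βstar‖ ≤ α) :
    ∃ δ > 0, ∀ m < mstar, ∀ β : Coeff d m, ‖β‖ ≤ α →
      δ ≤ ∫ ω, (inner ℝ β (truncSig m (X ω)) - inner ℝ βstar (truncSig mstar (X ω))) ^ 2 ∂P := by
  have hbd : ∀ (m : ℕ) (β : Coeff d m), ‖β‖ ≤ α → ∀ᵐ ω ∂P,
      ‖(inner ℝ β (truncSig m (X ω)) - inner ℝ βstar (truncSig mstar (X ω))) ^ 2‖
        ≤ (α * B + α * B) ^ 2 := by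
    intro m β hβ
    filter_upwards [hB] with ω hω
    rw [norm_pow]
    exact pow_le_pow_left₀ (norm_nonneg _) ((norm_sub_le _ _).trans
      (add_le_add (abs_inner_truncSig_le hβ (hω m)) (abs_inner_truncSig_le hβα (hω mstar)))) 2
  have hmeas : ∀ (m : ℕ) (β : Coeff d m), Measurable fun ω =>
      (inner ℝ β (truncSig m (X ω)) - inner ℝ βstar (truncSig mstar (X ω)) : ℝ) ^ 2 :=
    fun m β => (((measurable_inner_truncSig_right β).comp hX).sub
      ((measurable_inner_truncSig_right βstar).comp hX)).pow_const 2
  have hone : ∀ m < mstar, ∃ δ > 0, ∀ β : Coeff d m, ‖β‖ ≤ α →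
      δ ≤ ∫ ω, (inner ℝ β (truncSig m (X ω)) - inner ℝ βstar (truncSig mstar (X ω))) ^ 2 ∂P := by
    intro m hm
    have hcont : ContinuousOn (fun β : Coeff d m => ∫ ω, (inner ℝ β (truncSig m (X ω)) -
        inner ℝ βstar (truncSig mstar (X ω)) : ℝ) ^ 2 ∂P) (Metric.closedBall 0 α) := by
      refine continuousOn_of_dominated (fun β _ => (hmeas m β).aestronglyMeasurable)
        (fun β hβ => hbd m β (by simpa using hβ)) (integrable_const _)
        (Eventually.of_forall fun ω => ?_)
      fun_prop
    obtain ⟨β₀, hβ₀, hβ₀min⟩ := (isCompact_closedBall (0 : Coeff d m) α).exists_isMinOn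
      ⟨0, by simpa using hα⟩ hcont
    -- Were the minimum over the compact ball zero, its minimizer would represent the regression
    -- function at an order below the minimal one.
    refine ⟨_, lt_of_le_of_ne (integral_nonneg fun ω => sq_nonneg _) fun h0 => ?_,
      fun β hβ => hβ₀min (by simpa using hβ)⟩
    have hβ₀' : ‖β₀‖ ≤ α := by simpa using hβ₀
    have hae := (integral_eq_zero_iff_of_nonneg (fun ω => sq_nonneg _)
      (Integrable.of_bound (hmeas m β₀).aestronglyMeasurable _ (hbd m β₀ hβ₀'))).1 h0.symm
    refine absurd (hmin m ⟨β₀, hβstar.trans ?_⟩) (not_le.2 hm)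
    filter_upwards [hae] with ω hω
    have : (inner ℝ β₀ (truncSig m (X ω)) - inner ℝ βstar (truncSig mstar (X ω)) : ℝ) = 0 := by
      simpa using hω
    linarith
  choose! δ hδ hδle using hone
  rcases Nat.eq_zero_or_pos mstar with h0 | hpos
  · exact ⟨1, one_pos, fun m hm => by lia⟩
  · obtain ⟨m₀, hm₀, hmin₀⟩ := (Finset.range mstar).exists_min_image δ ⟨0, by simpa using hpos⟩
    exact ⟨δ m₀, hδ _ (by simpa using hm₀),
      fun m hm β hβ => (hmin₀ m (by simpa using hm)).trans (hδle m hm β hβ)⟩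

theorem excess_risk_eq_quadForm (hX : Measurable X) {B : ℝ}
    (hB : ∀ᵐ ω ∂P, ∀ m, ‖truncSig m (X ω)‖ ≤ B) {m m' M : ℕ} (hm : m ≤ M) (hm' : m' ≤ M)
    (β : Coeff d m) (β' : Coeff d m') :
    ∫ ω, (inner ℝ β (truncSig m (X ω)) - inner ℝ β' (truncSig m' (X ω))) ^ 2 ∂P
      = quadForm (fun p => ∫ ω, truncSig M (X ω) p.1 * truncSig M (X ω) p.2 ∂P)
        (pad M β - pad M β') := by
  have := integral_inner_sq_of_indepFun (P := P) (Γ := fun _ => pad M β - pad M β')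
    (S := fun ω => truncSig M (X ω)) measurable_const ((measurable_truncSig M).comp hX)
    (fun _ => le_rfl) (hB.mono fun ω hω => hω M) (indepFun_const_left _ _)
  simpa [inner_pad_sub_pad_truncSig hm hm'] using this

end Regression

end SigReg

/-! ### Fluctuation bound and absorption of the penalty. -/

namespace SigReg

variable {d : ℕ}

/-- The uniform fluctuation of the empirical risk at order `M` over the ball of radius `α`: the
first term holds the empirical correlations of the residuals with the signature, the second one
the deviations of the empirical second moments of the signature. -/
noncomputable def fluctuation {Ω : Type*} [MeasurableSpace Ω] (P : Measure Ω) (X : Ω → BVPath d)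
    (Y : Ω → ℝ) {mstar : ℕ} (βstar : Coeff d mstar) (α : ℝ) (M : ℕ) {n : ℕ} (D : Sample d n) : ℝ :=
  let r : BVPath d × ℝ → ℝ := fun z => z.2 - inner ℝ βstar (truncSig mstar z.1)
  4 * α * √(∑ w : Word d M, (1 / (n : ℝ) * ∑ i, r (D i) * truncSig M (D i).1 w -
      ∫ ω, r (X ω, Y ω) * truncSig M (X ω) w ∂P) ^ 2) +
  4 * α ^ 2 * √(∑ p : Word d M × Word d M,
    (1 / (n : ℝ) * ∑ i, truncSig M (D i).1 p.1 * truncSig M (D i).1 p.2 -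
      ∫ ω, truncSig M (X ω) p.1 * truncSig M (X ω) p.2 ∂P) ^ 2)

section Estimation

variable {Ω : Type*} [MeasurableSpace Ω] {P : Measure Ω} [IsProbabilityMeasure P]
  {X : Ω → BVPath d} {Y : Ω → ℝ} {mstar : ℕ} {βstar : Coeff d mstar}

/-- An estimator whose penalized empirical risk is at most that of the true coefficients has an
excess risk controlled by the fluctuation and the penalties. -/
theorem quadForm_le_fluctuation_add (hβstar : IsRegression P X Y mstar βstar) (hX : Measurable X)
    (hY : Measurable Y) {B K α : ℝ} (hB : ∀ᵐ ω ∂P, ∀ m, ‖truncSig m (X ω)‖ ≤ B)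
    (hK : ∀ᵐ ω ∂P, |Y ω| ≤ K) (hβα : ‖βstar‖ ≤ α) {m M n : ℕ} (hm : m ≤ M) (hM : mstar ≤ M)
    {β : Coeff d m} (hβ : ‖β‖ ≤ α) (D : Sample d n) {a b : ℝ}
    (hle : empRisk D m β + a ≤ empRisk D mstar βstar + b) :
    quadForm (fun p => ∫ ω, truncSig M (X ω) p.1 * truncSig M (X ω) p.2 ∂P)
      (pad M β - pad M βstar) ≤ fluctuation P X Y βstar α M D + b - a := by
  have hα : 0 ≤ α := (norm_nonneg _).trans hβ
  have hγ := norm_pad_sub_pad_le hm hM hβ hβα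
  have h1 := empRisk_sub_empRisk D hm hM β βstar
  have h2 := quadForm_le_add (fun p => ∫ ω, truncSig M (X ω) p.1 * truncSig M (X ω) p.2 ∂P)
    (fun p => 1 / (n : ℝ) * ∑ i, truncSig M (D i).1 p.1 * truncSig M (D i).1 p.2)
    (pad M β - pad M βstar)
  have h3 := (le_abs_self _).trans (abs_sum_mul_le_norm_mul_sqrt (pad M β - pad M βstar)
    fun w : Word d M => 1 / (n : ℝ) * ∑ i, ((D i).2 - inner ℝ βstar (truncSig mstar (D i).1)) *
      truncSig M (D i).1 w)
  simp only [fluctuation, hβstar.integral_residual_mul_eq_zero hX hY hB hK, sub_zero]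
  -- The diameter `2α` of the ball gives the weight `(2α)²` of the quadratic deviation and `2 · 2α`
  -- of the linear one.
  have h4 : ‖pad M β - pad M βstar‖ ^ 2 ≤ (2 * α) ^ 2 := by gcongr
  have h5 := mul_le_mul_of_nonneg_right h4 (Real.sqrt_nonneg (∑ p : Word d M × Word d M,
    (1 / (n : ℝ) * ∑ i, truncSig M (D i).1 p.1 * truncSig M (D i).1 p.2 -
      ∫ ω, truncSig M (X ω) p.1 * truncSig M (X ω) p.2 ∂P) ^ 2))
  have h6 := mul_le_mul_of_nonneg_right hγ (Real.sqrt_nonneg (∑ w : Word d M,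
    (1 / (n : ℝ) * ∑ i, ((D i).2 - inner ℝ βstar (truncSig mstar (D i).1)) *
      truncSig M (D i).1 w) ^ 2))
  linarith

theorem integral_fluctuation_le (hX : Measurable X) (hY : Measurable Y)
    {Xs : ℕ → Ω → BVPath d} {Ys : ℕ → Ω → ℝ}
    (hident : ∀ i, IdentDistrib (fun ω => (Xs i ω, Ys i ω)) (fun ω => (X ω, Y ω)) P P)
    (hindep : iIndepFun (fun i ω => (Xs i ω, Ys i ω)) P)
    {B K α : ℝ} (hB0 : 0 ≤ B) (hK0 : 0 ≤ K) (hB : ∀ᵐ ω ∂P, ∀ m, ‖truncSig m (X ω)‖ ≤ B)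
    (hK : ∀ᵐ ω ∂P, |Y ω| ≤ K) (hβα : ‖βstar‖ ≤ α) (M : ℕ) {n : ℕ} (hn : 0 < n) :
    Integrable (fun ω => fluctuation P X Y βstar α M fun i : Fin n => (Xs i ω, Ys i ω)) P ∧
    ∫ ω, fluctuation P X Y βstar α M (fun i : Fin n => (Xs i ω, Ys i ω)) ∂P
      ≤ (4 * α * ((K + α * B) * B) + 4 * α ^ 2 * B ^ 2) * (n : ℝ) ^ (-(1 / 2) : ℝ) := by
  have hα : 0 ≤ α := (norm_nonneg _).trans hβα
  let r : BVPath d × ℝ → ℝ := fun z => z.2 - inner ℝ βstar (truncSig mstar z.1)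
  have hr : Measurable r :=
    measurable_snd.sub ((measurable_inner_truncSig_right βstar).comp measurable_fst)
  have hZ : Measurable fun ω => (X ω, Y ω) := hX.prodMk hY
  have hrb : ∀ᵐ ω ∂P, |r (X ω, Y ω)| ≤ K + α * B := by
    filter_upwards [hB, hK] with ω h1 h2
    exact (abs_sub _ _).trans (add_le_add h2 (abs_inner_truncSig_le hβα (h1 mstar)))
  have hS : ∀ w : Word d M, Measurable fun z : BVPath d × ℝ => truncSig M z.1 w :=
    fun w => (measurable_truncSig_apply w).comp measurable_fst
  have hSb : ∀ᵐ ω ∂P, ∀ w : Word d M, |truncSig M (X ω) w| ≤ B :=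
    hB.mono fun ω hω w => (EuclideanSpace.abs_apply_le_norm _ w).trans (hω M)
  have hWm : ∀ w : Word d M, Measurable fun z : BVPath d × ℝ => r z * truncSig M z.1 w :=
    fun w => hr.mul (hS w)
  have hGm : ∀ p : Word d M × Word d M,
      Measurable fun z : BVPath d × ℝ => truncSig M z.1 p.1 * truncSig M z.1 p.2 :=
    fun p => (hS p.1).mul (hS p.2)
  have hW := integral_sqrt_sum_sq_mean_sub_le (P := P) hident hindep hWm
    (C := ((K + α * B) * B) ^ 2)
    (fun w => MemLp.of_bound ((hWm w).comp hZ).aestronglyMeasurable ((K + α * B) * B) (by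
      filter_upwards [hrb, hSb] with ω h1 h2
      rw [norm_mul]
      exact mul_le_mul h1 (h2 w) (abs_nonneg _) (by positivity)))
    (by
      filter_upwards [hrb, hB] with ω h1 h2
      simp only [mul_pow, ← Finset.mul_sum]
      rw [← EuclideanSpace.real_norm_sq_eq, ← sq_abs (r _)]
      have := h2 M
      gcongr) hn
  have hG := integral_sqrt_sum_sq_mean_sub_le (P := P) hident hindep hGm (C := (B ^ 2) ^ 2)
    (fun p => MemLp.of_bound ((hGm p).comp hZ).aestronglyMeasurable (B * B) (by
      filter_upwards [hSb] with ω h2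
      rw [norm_mul]
      exact mul_le_mul (h2 p.1) (h2 p.2) (abs_nonneg _) hB0))
    (by
      filter_upwards [hB] with ω h2
      rw [sum_sq_mul_self_eq_norm]
      have := h2 M
      gcongr) hn
  have hsqrt : ∀ c : ℝ, 0 ≤ c → √(c ^ 2 / n) = c * (n : ℝ) ^ (-(1 / 2) : ℝ) := fun c hc => by
    rw [Real.sqrt_div (sq_nonneg c), Real.sqrt_sq hc, Real.rpow_neg (by positivity),
      ← Real.sqrt_eq_rpow, div_eq_mul_inv]
  rw [hsqrt _ (by positivity)] at hW hG
  constructor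
  · exact (hW.1.const_mul _).add (hG.1.const_mul _)
  · simp only [fluctuation]
    rw [integral_add (hW.1.const_mul _) (hG.1.const_mul _), integral_const_mul,
      integral_const_mul]
    calc _ ≤ 4 * α * ((K + α * B) * B * (n : ℝ) ^ (-(1 / 2) : ℝ))
          + 4 * α ^ 2 * (B ^ 2 * (n : ℝ) ^ (-(1 / 2) : ℝ)) :=
        add_le_add (mul_le_mul_of_nonneg_left hW.2 (by positivity))
          (mul_le_mul_of_nonneg_left hG.2 (by positivity))
      _ = _ := by ring

/-- Once the penalty of the true order is below half the gap, the excess risk of the selected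
estimator is at most twice the fluctuation. -/
theorem quadForm_mHat_le (hd : 1 ≤ d) (hβstar : IsRegression P X Y mstar βstar)
    (hX : Measurable X) (hY : Measurable Y) {B K α : ℝ}
    (hB : ∀ᵐ ω ∂P, ∀ m, ‖truncSig m (X ω)‖ ≤ B) (hK : ∀ᵐ ω ∂P, |Y ω| ≤ K) (hβα : ‖βstar‖ ≤ α)
    {δ : ℝ} (hδ : ∀ m < mstar, ∀ β : Coeff d m, ‖β‖ ≤ α →
      δ ≤ ∫ ω, (inner ℝ β (truncSig m (X ω)) - inner ℝ βstar (truncSig mstar (X ω))) ^ 2 ∂P)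
    {Kpen ρ : ℝ} (hKpen : 0 < Kpen) {n M : ℕ} (hn : 0 < n) (hpen : pen d Kpen ρ n mstar ≤ δ / 2)
    {b : ∀ m, Sample d n → Coeff d m} (hb : ∀ m, IsERM α (b m)) (D : Sample d n)
    (hM : mstar ≤ M) (hm : mHat α Kpen ρ D ≤ M) :
    quadForm (fun p => ∫ ω, truncSig M (X ω) p.1 * truncSig M (X ω) p.2 ∂P)
      (pad M (b (mHat α Kpen ρ D) D) - pad M βstar) ≤ 2 * fluctuation P X Y βstar α M D := by
  set m := mHat α Kpen ρ D with hmdef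
  have hbα := (hb m).norm_le D
  have hα : 0 ≤ α := (norm_nonneg _).trans hβα
  have hle : empRisk D m (b m D) + pen d Kpen ρ n m
      ≤ empRisk D mstar βstar + pen d Kpen ρ n mstar := by
    have h := mHat_le hd α hKpen ρ hn D mstar
    rw [← hmdef, (hb m).minEmpRisk_eq, (hb mstar).minEmpRisk_eq] at h
    exact h.trans (by gcongr; exact (hb mstar).isMin D βstar hβα)
  have hq := quadForm_le_fluctuation_add hβstar hX hY hB hK hβα hm hM hbα D hle
  have hV : 0 ≤ fluctuation P X Y βstar α M D := by unfold fluctuation; positivity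
  rcases le_or_gt mstar m with h | h
  · have := pen_mono (d := d) hKpen.le ρ n h
    linarith
  -- The excess risk is at least `δ`, so the penalty of the true order, at most `δ / 2`, is at most
  -- half of it and moves to the left side; this is the factor 2.
  · have h1 := hδ m h (b m D) hbα
    rw [excess_risk_eq_quadForm hX hB hm hM] at h1
    have := pen_nonneg (d := d) hKpen.le ρ n m
    linarith

/-- The excess prediction `⟨b(D), S^m(x)⟩ - ⟨βstar, S^{mstar}(x)⟩` at the selected order
`m = mHat D`, as a vector of order `M` if `m ≤ M`, and zero otherwise. -/
noncomputable def truncExcess (βstar : Coeff d mstar) (α Kpen ρ : ℝ) {n : ℕ}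
    (b : ∀ m, Sample d n → Coeff d m) (M : ℕ) (D : Sample d n) : Coeff d M :=
  if mHat α Kpen ρ D ≤ M then pad M (b (mHat α Kpen ρ D) D) - pad M βstar else 0

theorem measurable_truncExcess {α : ℝ} (Kpen ρ : ℝ) {n : ℕ}
    {b : ∀ m, Sample d n → Coeff d m} (hb : ∀ m, IsERM α (b m)) (M : ℕ) :
    Measurable (truncExcess βstar α Kpen ρ b M) := by
  -- The type of the estimator varies with the order; freezing the order, which is countable,
  -- reduces measurability to each slice.
  have h : Measurable fun z : ℕ × Sample d n =>
      if z.1 ≤ M then pad M (b z.1 z.2) - pad M βstar else 0 := by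
    refine measurable_from_prod_countable_right fun m => ?_
    by_cases hm : m ≤ M
    · simp only [hm, if_true]
      exact ((measurable_pad m M).comp (hb m).measurable).sub_const _
    · simp only [hm, if_false]
      exact measurable_const
  exact h.comp ((measurable_mHat Kpen ρ hb).prodMk measurable_id)

end Estimation

end SigReg

/-! ### The convergence rate. -/

theorem corollary1 {Ω : Type*} [MeasurableSpace Ω] (P : Measure Ω) [IsProbabilityMeasure P]
    {d : ℕ} (hd : 1 ≤ d)
    -- the generic pair and the observations
    (X : Ω → SigReg.BVPath d) (Y : Ω → ℝ) (Xs : ℕ → Ω → SigReg.BVPath d) (Ys : ℕ → Ω → ℝ)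
    (hX : Measurable X) (hY : Measurable Y)
    (hXs : ∀ i, Measurable (Xs i)) (hYs : ∀ i, Measurable (Ys i))
    -- the observations are i.i.d. copies of the generic pair, which is independent of them
    (hident : ∀ i, IdentDistrib (fun ω => (Xs i ω, Ys i ω)) (fun ω => (X ω, Y ω)) P P)
    (hindep : iIndepFun (fun i ω => (Xs i ω, Ys i ω)) P)
    (hfresh : IndepFun (fun ω => (X ω, Y ω)) (fun ω i => (Xs i ω, Ys i ω)) P)
    -- the signature linear model, with minimal truncation order `mstar`
    (mstar : ℕ) (hmstar : IsLeast {m | ∃ β, SigReg.IsRegression P X Y m β} mstar)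
    (βstar : SigReg.Coeff d mstar) (hβstar : SigReg.IsRegression P X Y mstar βstar)
    -- assumption `(H_α)`
    (α : ℝ) (hα : 0 < α) (hHα : ‖βstar‖ ≤ α)
    -- assumption `(H_K)`
    (KY KX : ℝ) (hKY : 0 < KY) (hKX : 0 < KX)
    (hHK : ∀ᵐ ω ∂P, |Y ω| ≤ KY ∧ (X ω).tv ≤ ENNReal.ofReal KX)
    -- the penalty parameters
    (Kpen ρ : ℝ) (hKpen : 0 < Kpen) (hρ : 0 < ρ) (hρ' : ρ < 1 / 2)
    -- the empirical risk minimizers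
    (βhat : ∀ n m : ℕ, SigReg.Sample d n → SigReg.Coeff d m)
    (hβhat : ∀ n m, SigReg.IsERM α (βhat n m)) :
    let D : (n : ℕ) → Ω → SigReg.Sample d n := fun n ω i => (Xs i ω, Ys i ω)
    let mhat : ℕ → Ω → ℕ := fun n ω => SigReg.mHat α Kpen ρ (D n ω)
    let err : ℕ → Ω → ℝ := fun n ω =>
      inner ℝ (βhat n (mhat n ω) (D n ω)) (SigReg.truncSig (mhat n ω) (X ω)) -
        inner ℝ βstar (SigReg.truncSig mstar (X ω))
    (∀ n, Integrable (fun ω => err n ω ^ 2) P) ∧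
      (fun n => ∫ ω, err n ω ^ 2 ∂P) =O[atTop] (fun n : ℕ => (n : ℝ) ^ (-(1 / 2) : ℝ)) := by
  intro D mhat err
  obtain ⟨B, hB0, hB⟩ := SigReg.exists_ae_norm_truncSig_le (hHK.mono fun ω h => h.2)
  have hK : ∀ᵐ ω ∂P, |Y ω| ≤ KY := hHK.mono fun ω h => h.1
  have hD : ∀ n, Measurable (D n) := fun n =>
    measurable_pi_lambda _ fun i => (hXs i).prodMk (hYs i)
  have hmhat : ∀ n, Measurable (mhat n) := fun n =>
    (SigReg.measurable_mHat Kpen ρ (hβhat n)).comp (hD n)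
  have herr : ∀ n, Measurable (err n) := by
    intro n
    have h : Measurable fun z : ℕ × Ω =>
        (inner ℝ (βhat n z.1 (D n z.2)) (SigReg.truncSig z.1 (X z.2)) : ℝ) :=
      measurable_from_prod_countable_right fun m => SigReg.measurable_inner_truncSig.comp
        (((hβhat n m).measurable.comp (hD n)).prodMk hX)
    exact (h.comp ((hmhat n).prodMk measurable_id)).sub
      ((SigReg.measurable_inner_truncSig_right βstar).comp hX)
  have hint : ∀ n, Integrable (fun ω => err n ω ^ 2) P := by
    intro n
    refine Integrable.of_bound ((herr n).pow_const 2).aestronglyMeasurable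
      ((α * B + α * B) ^ 2) (hB.mono fun ω hω => ?_)
    rw [norm_pow]
    exact pow_le_pow_left₀ (norm_nonneg _) ((norm_sub_le _ _).trans
      (add_le_add (SigReg.abs_inner_truncSig_le ((hβhat n _).norm_le _) (hω _))
        (SigReg.abs_inner_truncSig_le hHα (hω mstar)))) 2
  refine ⟨hint, ?_⟩
  obtain ⟨δ, hδ0, hδ⟩ := SigReg.exists_pos_le_excess_risk hX hB (fun m hm => hmstar.2 hm) hβstar
    hα.le hHα
  have hpen := (SigReg.tendsto_pen_zero (d := d) Kpen hρ mstar).eventually_le_const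
    (half_pos hδ0)
  refine Asymptotics.IsBigO.of_bound
    (2 * (4 * α * ((KY + α * B) * B) + 4 * α ^ 2 * B ^ 2)) ?_
  filter_upwards [hpen, eventually_gt_atTop 0] with n hpn hn
  rw [Real.norm_of_nonneg (integral_nonneg fun ω => sq_nonneg _),
    Real.norm_of_nonneg (by positivity)]
  -- On `{mhat ≤ M}` all vectors live in one fixed space; the bound there is free of `M`, so it
  -- passes to the increasing limit.
  have hset : ∀ M, MeasurableSet {ω | mhat n ω ≤ M} := fun M => hmhat n measurableSet_Iic
  have hunion : ⋃ M, {ω | mhat n ω ≤ M} = Set.univ :=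
    Set.eq_univ_of_forall fun ω => Set.mem_iUnion.2 ⟨mhat n ω, le_refl (mhat n ω)⟩
  have hlim := tendsto_setIntegral_of_monotone (μ := P) (f := fun ω => err n ω ^ 2) hset
    (fun M M' h ω (hω : _ ≤ _) => hω.trans h) (hint n).integrableOn
  rw [hunion, Measure.restrict_univ] at hlim
  refine le_of_tendsto hlim ((eventually_ge_atTop mstar).mono fun M hM => ?_)
  let Γ : Ω → SigReg.Coeff d M := fun ω =>
    SigReg.truncExcess βstar α Kpen ρ (βhat n) M (D n ω)
  have hΓm : Measurable Γ := (SigReg.measurable_truncExcess Kpen ρ (hβhat n) M).comp (hD n)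
  have hΓb : ∀ ω, ‖Γ ω‖ ≤ 2 * α := by
    intro ω
    simp only [Γ, SigReg.truncExcess]
    split_ifs with h
    · exact SigReg.norm_pad_sub_pad_le h hM ((hβhat n _).norm_le _) hHα
    · simpa using hα.le
  have hind : IndepFun Γ (fun ω => SigReg.truncSig M (X ω)) P :=
    hfresh.symm.comp
      (φ := fun s : ℕ → SigReg.BVPath d × ℝ =>
        SigReg.truncExcess βstar α Kpen ρ (βhat n) M fun i : Fin n => s i)
      (ψ := fun z : SigReg.BVPath d × ℝ => SigReg.truncSig M z.1)
      ((SigReg.measurable_truncExcess Kpen ρ (hβhat n) M).comp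
        (measurable_pi_lambda _ fun i => measurable_pi_apply _))
      ((SigReg.measurable_truncSig M).comp measurable_fst)
  obtain ⟨hVint, hVle⟩ := SigReg.integral_fluctuation_le (βstar := βstar) hX hY hident hindep hB0
    hKY.le hB hK hHα M hn
  calc ∫ ω in {ω | mhat n ω ≤ M}, err n ω ^ 2 ∂P
      = ∫ ω, inner ℝ (Γ ω) (SigReg.truncSig M (X ω)) ^ 2 ∂P := by
        rw [← integral_indicator (hset M)]
        refine integral_congr_ae (Eventually.of_forall fun ω => ?_)
        by_cases h : mhat n ω ≤ M
        · rw [Set.indicator_of_mem (by exact h)]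
          simp only [Γ, SigReg.truncExcess]
          rw [if_pos h, SigReg.inner_pad_sub_pad_truncSig h hM]
        · rw [Set.indicator_of_notMem (by exact h)]
          simp only [Γ, SigReg.truncExcess]
          rw [if_neg h]
          simp
    _ = ∫ ω, quadForm (fun p => ∫ ω, SigReg.truncSig M (X ω) p.1 * SigReg.truncSig M (X ω) p.2 ∂P)
          (Γ ω) ∂P :=
        integral_inner_sq_of_indepFun hΓm ((SigReg.measurable_truncSig M).comp hX) hΓb
          (hB.mono fun ω hω => hω M) hind
    _ ≤ ∫ ω, 2 * SigReg.fluctuation P X Y βstar α M (D n ω) ∂P := by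
        refine integral_mono_of_nonneg (Eventually.of_forall fun ω => ?_) (hVint.const_mul 2)
          (Eventually.of_forall fun ω => ?_)
        -- With `Γ` frozen at its value, the form is the mean of a square, hence nonnegative.
        · have h := integral_inner_sq_of_indepFun (P := P) (Γ := fun _ => Γ ω)
            measurable_const ((SigReg.measurable_truncSig M).comp hX) (fun _ => le_rfl)
            (hB.mono fun ω hω => hω M) (indepFun_const_left _ _)
          simp only [integral_const, probReal_univ, one_smul] at h
          exact (integral_nonneg fun _ => sq_nonneg _).trans_eq h
        · simp only [Γ, SigReg.truncExcess]
          split_ifs with h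
          · exact SigReg.quadForm_mHat_le hd hβstar hX hY hB hK hHα hδ hKpen hn hpn (hβhat n) _ hM h
          · have : 0 ≤ SigReg.fluctuation P X Y βstar α M (D n ω) := by
              unfold SigReg.fluctuation; positivity
            simpa [quadForm] using this
    _ ≤ 2 * ((4 * α * ((KY + α * B) * B) + 4 * α ^ 2 * B ^ 2) * (n : ℝ) ^ (-(1 / 2) : ℝ)) := by
        rw [integral_const_mul]
        gcongr
    _ = _ := by ring
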